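/- **Setting.** Let $d\in\mathbb N$, $\alpha\ge 0$, $\beta\ge 0$, and let $\sigma_0:\mathbb R\to\mathbb R$ be twice differentiable with $|\sigma_0(x)|\le C_1\max(|x|,1)$, $|\sigma_0'(x)|\le C_1$ and $|\sigma_0''(x)|\le C_1$ for all $x$. For $z\in\mathbb R^d$ put $$\boldsymbol\sigma(z,\theta)=u\,\sigma_0(w^\top z+b),\quad \theta=(u,w,b)\in\mathbb R^{d}\times\mathbb R^d\times\mathbb R,\qquad h(z,\omega)=a\,\sigma_0(w^\top z+b),\quad \omega=(a,w,b)\in\mathbb R\times\mathbb R^d\times\mathbb R .$$ Let $\tau_0$ and $\nu_0$ be the standard Gaussian measures on $\mathbb R^{d+2}$ and $\mathbb R^{2d+1}$. Given a probability measure $\tau$ on $\mathbb R^{d+2}$ with finite second moment and a measurable family $\nu=(\nu^s)_{s\in[0,1]}$ of probability measures on $\mathbb R^{2d+1}$ with finite second moments, let $Z_\nu(x,\cdot)$ be the solution on $[0,1]$ (in integral form) of $$\frac{d Z}{d s}(x,s)=\alpha\int \boldsymbol\sigma(Z(x,s),\theta)\,d\nu^s(\theta),\qquad Z(x,0)=x,$$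 and let $f_{\tau,\nu}(x)=\beta\int h(Z_\nu(x,1),\omega)\,d\tau(\omega)$ be the associated ResNet of infinite width and infinite depth. For $r>0$ let $$\mathcal F_{\mathrm{KL}}(r)=\bigl\{f_{\tau,\nu}:\ \mathrm{KL}(\tau\|\tau_0)\le r,\ \ \mathrm{KL}(\nu^s\|\nu_0)\le r\ \text{ for all } s\in[0,1]\bigr\}.$$ For a sample $x_1,\dots,x_n$ and i.i.d. signs $\eta_1,\dots,\eta_n$, uniform on $\{\pm1\}$, let $\mathcal R_n(\mathcal H)=\mathbb E_\eta\bigl[\sup_{f\in\mathcal H}\frac1n\sum_{i=1}^n\eta_i f(x_i)\bigr]$. **Lemma (Rademacher complexity of the KL ball).** There are constants $c>0$ and $C>0$, depending only on $d$, $\alpha$ and $C_1$, such that for all $\sigma_0$ and $\beta$ as above, all $n\ge1$, all $x_1,\dots,x_n\in\mathbb R^d$ with $\|x_i\|_2\le 1$, and all $0<r\le r_0:=c/\sqrt n$, the suprema in the definition of $\mathcal R_n(\mathcal F_{\mathrm{KL}}(r))$ are finite and $$\mathcal R_n(\mathcal F_{\mathrm{KL}}(r))\ \le\ C\,\beta\,\sqrt{r/n}.$$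 -/

import Mathlib

open MeasureTheory ProbabilityTheory InformationTheory Set
open scoped ENNReal RealInnerProductSpace

noncomputable section

/-- Euclidean space of dimension `d`, in which data and hidden states live. -/
abbrev Feat (d : ℕ) := EuclideanSpace ℝ (Fin d)

/-- Parameters `θ = (u, w, b)` of the residual layers (total dimension `2d + 1`). -/
abbrev LayerParam (d : ℕ) := Feat d × Feat d × ℝ

/-- Parameters `ω = (a, w, b)` of the output layer (total dimension `d + 2`). -/
abbrev OutParam (d : ℕ) := ℝ × Feat d × ℝ

/-- The standing assumption on the scalar activation `σ₀`, with constant `C₁`: twice differentiable,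
at most linear growth, bounded first and second derivatives. -/
structure IsActivation (C₁ : ℝ) (σ₀ : ℝ → ℝ) : Prop where
  differentiable : Differentiable ℝ σ₀
  differentiable_deriv : Differentiable ℝ (deriv σ₀)
  growth : ∀ x, |σ₀ x| ≤ C₁ * max |x| 1
  deriv_le : ∀ x, |deriv σ₀ x| ≤ C₁
  deriv2_le : ∀ x, |deriv (deriv σ₀) x| ≤ C₁

/-- The residual block `σ(z, θ) = u σ₀(wᵀ z + b)`. -/
def layerMap {d : ℕ} (σ₀ : ℝ → ℝ) (z : Feat d) (θ : LayerParam d) : Feat d :=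
  σ₀ (⟪θ.2.1, z⟫ + θ.2.2) • θ.1

/-- The predictor `h(z, ω) = a σ₀(wᵀ z + b)`. -/
def outMap {d : ℕ} (σ₀ : ℝ → ℝ) (z : Feat d) (ω : OutParam d) : ℝ :=
  ω.1 * σ₀ (⟪ω.2.1, z⟫ + ω.2.2)

/-- The standard Gaussian `ν₀ˢ` on `ℝ^(2d+1)` (the same for every layer `s`). -/
def layerInit (d : ℕ) : Measure (LayerParam d) :=
  (stdGaussian (Feat d)).prod ((stdGaussian (Feat d)).prod (gaussianReal 0 1))

/-- The standard Gaussian `τ₀` on `ℝ^(d+2)`. -/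
def outInit (d : ℕ) : Measure (OutParam d) :=
  (gaussianReal 0 1).prod ((stdGaussian (Feat d)).prod (gaussianReal 0 1))

/-- `μ ∈ 𝒫²` on `ℝ^(2d+1)`: a probability measure with finite second moment. -/
def LayerP2 {d : ℕ} (μ : Measure (LayerParam d)) : Prop :=
  IsProbabilityMeasure μ ∧ Integrable (fun θ ↦ ‖θ.1‖ ^ 2 + ‖θ.2.1‖ ^ 2 + θ.2.2 ^ 2) μ

/-- `μ ∈ 𝒫²` on `ℝ^(d+2)`: a probability measure with finite second moment. -/
def OutP2 {d : ℕ} (μ : Measure (OutParam d)) : Prop :=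
  IsProbabilityMeasure μ ∧ Integrable (fun ω ↦ ω.1 ^ 2 + ‖ω.2.1‖ ^ 2 + ω.2.2 ^ 2) μ

/-- The right-hand side `α ∫ σ(z, θ) dνˢ(θ)` of the mean-field ODE. -/
def drift {d : ℕ} (σ₀ : ℝ → ℝ) (α : ℝ) (ν : Kernel ℝ (LayerParam d)) (s : ℝ) (z : Feat d) :
    Feat d :=
  α • ∫ θ, layerMap σ₀ z θ ∂(ν s)

/-- `Z` solves `dZ/ds = α ∫ σ(Z, θ) dνˢ(θ)`, `Z 0 = x`, on `[0, 1]`, in integral form (the layer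
distributions `νˢ` are only assumed to depend measurably on `s`). -/
structure IsFlow {d : ℕ} (σ₀ : ℝ → ℝ) (α : ℝ) (ν : Kernel ℝ (LayerParam d)) (x : Feat d)
    (Z : ℝ → Feat d) : Prop where
  continuousOn : ContinuousOn Z (Icc 0 1)
  integrable : IntervalIntegrable (fun t ↦ drift σ₀ α ν t (Z t)) volume 0 1
  eq : ∀ s ∈ Icc (0 : ℝ) 1, Z s = x + ∫ t in (0 : ℝ)..s, drift σ₀ α ν t (Z t)

/-- `f = f_{τ,ν}`, i.e. `f x = β ∫ h(Z_ν(x, 1), ω) dτ(ω)`, the ResNet of infinite depth and width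
with output distribution `τ ∈ 𝒫²` and layer distributions `νˢ ∈ 𝒫²`, `s ∈ [0, 1]`.
Only the values of `ν` at parameters in `[0, 1]` matter. -/
def IsResNet {d : ℕ} (σ₀ : ℝ → ℝ) (α β : ℝ) (τ : Measure (OutParam d))
    (ν : Kernel ℝ (LayerParam d)) (f : Feat d → ℝ) : Prop :=
  OutP2 τ ∧ (∀ s ∈ Icc (0 : ℝ) 1, LayerP2 (ν s)) ∧
    ∃ Z : Feat d → ℝ → Feat d, (∀ x, IsFlow σ₀ α ν x (Z x)) ∧
      ∀ x, f x = β * ∫ ω, outMap σ₀ (Z x 1) ω ∂τ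

/-- The class `F_KL(r)`: ResNets `f_{τ,ν}` with `KL(τ‖τ₀) ≤ r` and `KL(νˢ‖ν₀ˢ) ≤ r` for all
`s ∈ [0, 1]`. -/
def klClass (d : ℕ) (σ₀ : ℝ → ℝ) (α β r : ℝ) : Set (Feat d → ℝ) :=
  {f | ∃ (τ : Measure (OutParam d)) (ν : Kernel ℝ (LayerParam d)), IsResNet σ₀ α β τ ν f ∧
    klDiv τ (outInit d) ≤ ENNReal.ofReal r ∧
    ∀ s ∈ Icc (0 : ℝ) 1, klDiv (ν s) (layerInit d) ≤ ENNReal.ofReal r}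

/-- `(1/n) ∑ᵢ ηᵢ f(xᵢ)` for signs `η`. -/
def signedMean {X : Type*} {n : ℕ} (x : Fin n → X) (η : Fin n → ℤˣ) (f : X → ℝ) : ℝ :=
  (1 / (n : ℝ)) * ∑ i, ((η i : ℤ) : ℝ) * f (x i)

/-- Rademacher complexity of `H` on the sample `x`: the mean over all `2 ^ n` sign vectors `η`, i.e.
over i.i.d. uniform signs, of `sup_{f ∈ H} (1/n) ∑ᵢ ηᵢ f(xᵢ)`. -/
def rademacher {X : Type*} {n : ℕ} (x : Fin n → X) (H : Set (X → ℝ)) : ℝ :=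
  (1 / (2 : ℝ) ^ n) * ∑ η : Fin n → ℤˣ, ⨆ f : H, signedMean x η f.1

end

noncomputable section

/-! For fixed signs `η` the signed mean of an output is `β ∫ H dτ`, where `H = a · g(w, b)` and `g`
is a signed average of neurons at the end points `Z i 1`. Since `a` is a centred Gaussian
independent of `(w, b)`, `H` integrates to zero under `τ₀`. Relative-entropy duality then gives `∫ H
dτ ≤ r/λ + λ ∫ H² exp(κ'(1 + ‖ω‖²)) dτ₀` (`integral_le_of_klDiv_le`), provided `λ K' ≤ κ'` when `|H|
≤ K' (1 + ‖ω‖²)`. If `∫ H² ...` has sign-mean `O(1/n)`, then `λ = √(rn)` yields the rate `√(r/n)`.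

Two obstacles remain. First, `H` depends on `ν` through the flow, so `H²` needs a majorant depending
on `η` only. Trajectories move by `O(√r)`. A Taylor expansion leaves an `O(r)` remainder and a
linear term, which is the integral against `νˢ` of a function centred under `ν₀`. The same duality
bounds that term by `O(r)` plus a variance `tangentVar`, free of `ν` and of sign-mean `O(1/n)`
(`abs_signAvg_flow_sub_le`, `signMean_tangentVar_le`). Squared, these contributions are `O(r² + 1/n)
= O(1/n)` in mean, because `r ≤ 1/√n`.

Second, the constraint on `λ` costs `r K'/κ'`. A bounded `K'` would give only `O(r)`, too large once
`r > 1/n`. A uniform law for ridge functions (`exists_ridge_envelope`) makes the part of `K'` from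
the initial points `O(n^(-1/4))` in mean, and the flow adds `O(√r)`. Both `r n^(-1/4)` and `r √r`
are at most `√(r/n)` exactly when `r ≤ 1/√n`. The argument is assembled in `integral_signAvg_le`. -/

theorem exp_sub_one_sub_self_le (x : ℝ) : Real.exp x - 1 - x ≤ x ^ 2 * Real.exp |x| := by
  have h : Real.exp x - 1 ≤ x * Real.exp x := by
    have h1 := Real.add_one_le_exp (-x)
    have h2 : Real.exp x * Real.exp (-x) = 1 := by rw [← Real.exp_add]; simp
    nlinarith [Real.exp_pos x]
  rcases le_total 0 x with hx | hx
  · rw [abs_of_nonneg hx]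
    nlinarith
  · have h1 : (1 : ℝ) ≤ Real.exp |x| := Real.one_le_exp (abs_nonneg x)
    have h2 := Real.add_one_le_exp x
    nlinarith [sq_nonneg x]

/-- Fenchel–Young for the conjugate pair `klFun` and `exp t - 1`, read off the tangent line of `exp`
at `log ρ`. Integrated with `ρ` a density, it plays the role of the Donsker–Varadhan formula. -/
theorem mul_le_klFun_add_exp (t : ℝ) {ρ : ℝ} (hρ : 0 ≤ ρ) :
    t * ρ ≤ klFun ρ + (Real.exp t - 1) := by
  rcases hρ.eq_or_lt with rfl | h
  · simp [klFun_zero, Real.exp_nonneg]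
  · have h1 := Real.add_one_le_exp (t - Real.log ρ)
    have h2 : ρ * Real.exp (t - Real.log ρ) = Real.exp t := by
      rw [Real.exp_sub, Real.exp_log h]; field_simp
    rw [klFun_apply]
    nlinarith

/-! ### Exponential moments and the transport inequality for relative entropy. -/

section Weight

variable {E : Type*} [NormedAddCommGroup E]

/-- The quadratic weight `1 + ‖x‖²`. -/
def quadWeight (x : E) : ℝ := 1 + ‖x‖ ^ 2

/-- The Gaussian-type weight `exp (κ (1 + ‖x‖²))`. -/
def expWeight (κ : ℝ) (x : E) : ℝ := Real.exp (κ * quadWeight x)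

theorem one_le_quadWeight (x : E) : 1 ≤ quadWeight x := by
  unfold quadWeight; nlinarith [sq_nonneg ‖x‖]

theorem quadWeight_pos (x : E) : 0 < quadWeight x := one_pos.trans_le (one_le_quadWeight x)

theorem expWeight_pos (κ : ℝ) (x : E) : 0 < expWeight κ x := Real.exp_pos _

theorem one_le_expWeight {κ : ℝ} (hκ : 0 ≤ κ) (x : E) : 1 ≤ expWeight κ x :=
  Real.one_le_exp (mul_nonneg hκ (quadWeight_pos x).le)

@[fun_prop]
theorem continuous_quadWeight : Continuous (quadWeight : E → ℝ) := by
  unfold quadWeight; fun_prop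

@[fun_prop]
theorem continuous_expWeight (κ : ℝ) : Continuous (expWeight κ : E → ℝ) := by
  unfold expWeight; fun_prop

theorem pow_le_quadWeight_cube (x : E) {k : ℕ} (hk : k ≤ 3) :
    quadWeight x ^ k ≤ quadWeight x ^ 3 :=
  pow_le_pow_right₀ (one_le_quadWeight x) hk

variable [MeasurableSpace E]

/-- `μ` has an exponential quadratic moment: `(1 + ‖x‖²)³ exp (κ (1 + ‖x‖²))` is integrable with
integral at most `Q`. -/
structure HasExpMoment (μ : Measure E) (κ Q : ℝ) : Prop where
  pos : 0 < κ
  integrable : Integrable (fun x ↦ quadWeight x ^ 3 * expWeight κ x) μ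
  integral_le : ∫ x, quadWeight x ^ 3 * expWeight κ x ∂μ ≤ Q

theorem HasExpMoment.nonneg {μ : Measure E} {κ Q : ℝ} (h : HasExpMoment μ κ Q) : 0 ≤ Q :=
  (integral_nonneg fun x ↦ mul_nonneg (pow_nonneg (quadWeight_pos x).le 3)
    (expWeight_pos κ x).le).trans h.integral_le

theorem HasExpMoment.integrable_of_le {μ : Measure E} {κ Q : ℝ} (h : HasExpMoment μ κ Q)
    {g : E → ℝ} (hg : AEStronglyMeasurable g μ) (C : ℝ)
    (hC : ∀ x, |g x| ≤ C * (quadWeight x ^ 3 * expWeight κ x)) : Integrable g μ :=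
  (h.integrable.const_mul C).mono' hg (ae_of_all _ hC)

theorem HasExpMoment.integral_le_of_le {μ : Measure E} {κ Q : ℝ} (h : HasExpMoment μ κ Q)
    {g : E → ℝ} (h0 : ∀ x, 0 ≤ g x) {C : ℝ} (hC0 : 0 ≤ C)
    (hC : ∀ x, g x ≤ C * (quadWeight x ^ 3 * expWeight κ x)) : ∫ x, g x ∂μ ≤ C * Q := by
  calc ∫ x, g x ∂μ ≤ ∫ x, C * (quadWeight x ^ 3 * expWeight κ x) ∂μ :=
        integral_mono_of_nonneg (ae_of_all _ h0) (h.integrable.const_mul C) (ae_of_all _ hC)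
    _ ≤ C * Q := by
        rw [integral_const_mul]; exact mul_le_mul_of_nonneg_left h.integral_le hC0

/-- Fernique's theorem gives integrability of `exp (C ‖x‖²)`. Half of the exponent is kept as `κ = C
/ 2`, and the other half absorbs the cubic factor through `t ≤ (3/κ) exp(κ t/3)`. -/
theorem exists_hasExpMoment [NormedSpace ℝ E] [BorelSpace E] [SecondCountableTopology E]
    [CompleteSpace E] (μ : Measure E) [IsGaussian μ] : ∃ κ Q : ℝ, HasExpMoment μ κ Q := by
  obtain ⟨C, hC, hi⟩ := IsGaussian.exists_integrable_exp_sq μ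
  refine ⟨C / 2, _, by positivity, ?_, le_rfl⟩
  have hi' : Integrable (fun x ↦ (3 / (C / 2)) ^ 3 * (Real.exp C * Real.exp (C * ‖x‖ ^ 2))) μ :=
    (hi.const_mul _).const_mul _
  refine hi'.mono' (by fun_prop) (ae_of_all _ fun x ↦ ?_)
  have hq := quadWeight_pos x
  rw [Real.norm_of_nonneg (mul_nonneg (pow_nonneg hq.le 3) (expWeight_pos _ x).le)]
  have h1 : quadWeight x ≤ 3 / (C / 2) * Real.exp (C / 2 * quadWeight x / 3) := by
    have := Real.add_one_le_exp (C / 2 * quadWeight x / 3)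
    calc quadWeight x = 3 / (C / 2) * (C / 2 * quadWeight x / 3) := by field_simp
      _ ≤ _ := by gcongr; linarith
  have h2 : quadWeight x ^ 3 ≤ (3 / (C / 2)) ^ 3 * Real.exp (C / 2 * quadWeight x) := by
    calc quadWeight x ^ 3 ≤ (3 / (C / 2) * Real.exp (C / 2 * quadWeight x / 3)) ^ 3 := by gcongr
      _ = _ := by rw [mul_pow, ← Real.exp_nat_mul]; congr 2; push_cast; ring
  calc quadWeight x ^ 3 * expWeight (C / 2) x
      ≤ (3 / (C / 2)) ^ 3 * Real.exp (C / 2 * quadWeight x) * Real.exp (C / 2 * quadWeight x) :=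
        mul_le_mul_of_nonneg_right h2 (expWeight_pos _ x).le
    _ = _ := by
        rw [mul_assoc, ← Real.exp_add, ← Real.exp_add]
        congr 2; unfold quadWeight; ring

/-- Transport inequality for relative entropy: integrals of centred functions of quadratic growth
over a measure with small relative entropy are small. -/
theorem integral_le_of_klDiv_le [BorelSpace E] {μ₀ μ : Measure E}
    [IsProbabilityMeasure μ₀] [IsProbabilityMeasure μ] {κ Q r : ℝ} (h₀ : HasExpMoment μ₀ κ Q)
    (hr : 0 ≤ r) (hkl : klDiv μ μ₀ ≤ ENNReal.ofReal r)
    {H : E → ℝ} (hH : AEStronglyMeasurable H μ₀) {K : ℝ} (hK : ∀ x, |H x| ≤ K * quadWeight x)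
    (hH0 : ∫ x, H x ∂μ₀ = 0) (hμ : Integrable H μ) {lam : ℝ} (hlam : 0 < lam)
    (hlamK : lam * K ≤ κ) :
    ∫ x, H x ∂μ ≤ r / lam + lam * ∫ x, H x ^ 2 * expWeight κ x ∂μ₀ := by
  have hne : klDiv μ μ₀ ≠ ∞ := (hkl.trans_lt ENNReal.ofReal_lt_top).ne
  obtain ⟨hac, hllr⟩ := klDiv_ne_top_iff.1 hne
  have hκ := h₀.pos
  have hklr : ∫ x, klFun (μ.rnDeriv μ₀ x).toReal ∂μ₀ ≤ r := by
    rw [← toReal_klDiv_eq_integral_klFun hac]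
    exact ENNReal.toReal_le_of_le_ofReal hr hkl
  have hkli : Integrable (fun x ↦ klFun (μ.rnDeriv μ₀ x).toReal) μ₀ :=
    (integrable_klFun_rnDeriv_iff hac).2 hllr
  have hlam' : ∀ x, |lam * H x| ≤ κ * quadWeight x := fun x ↦ by
    rw [abs_mul, abs_of_pos hlam]
    calc lam * |H x| ≤ lam * (K * quadWeight x) := by gcongr; exact hK x
      _ = lam * K * quadWeight x := by ring
      _ ≤ _ := mul_le_mul_of_nonneg_right hlamK (quadWeight_pos x).le
  have hqe : ∀ (x : E) {k : ℕ}, k ≤ 3 →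
      quadWeight x ^ k * expWeight κ x ≤ quadWeight x ^ 3 * expWeight κ x := fun x k hk ↦
    mul_le_mul_of_nonneg_right (pow_le_quadWeight_cube x hk) (expWeight_pos κ x).le
  have hHi : Integrable H μ₀ := by
    refine h₀.integrable_of_le hH |K| fun x ↦ (hK x).trans ?_
    have h1 := hqe x (k := 1) (by norm_num)
    have h2 := one_le_expWeight hκ.le x
    have h3 := quadWeight_pos x
    calc K * quadWeight x ≤ |K| * quadWeight x := by gcongr; exact le_abs_self K
      _ ≤ |K| * (quadWeight x ^ 1 * expWeight κ x) := by
        gcongr; nlinarith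
      _ ≤ _ := by gcongr
  have hH2 : Integrable (fun x ↦ H x ^ 2 * expWeight κ x) μ₀ := by
    refine h₀.integrable_of_le (by fun_prop) (K ^ 2) fun x ↦ ?_
    rw [abs_of_nonneg (mul_nonneg (sq_nonneg _) (expWeight_pos κ x).le)]
    have h1 : H x ^ 2 ≤ K ^ 2 * quadWeight x ^ 2 := by
      rw [← sq_abs, ← mul_pow]; exact pow_le_pow_left₀ (abs_nonneg _) (hK x) 2
    calc H x ^ 2 * expWeight κ x ≤ K ^ 2 * quadWeight x ^ 2 * expWeight κ x :=
          mul_le_mul_of_nonneg_right h1 (expWeight_pos κ x).le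
      _ = K ^ 2 * (quadWeight x ^ 2 * expWeight κ x) := by ring
      _ ≤ _ := by gcongr ?_ * ?_; exact hqe x (by norm_num)
  have hexp : Integrable (fun x ↦ Real.exp (lam * H x) - 1) μ₀ := by
    refine Integrable.sub ?_ (integrable_const _)
    refine h₀.integrable_of_le (by fun_prop) 1 fun x ↦ ?_
    rw [abs_of_pos (Real.exp_pos _), one_mul]
    calc Real.exp (lam * H x) ≤ quadWeight x ^ 0 * expWeight κ x := by
          rw [pow_zero, one_mul]
          exact Real.exp_le_exp.2 ((le_abs_self _).trans (hlam' x))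
      _ ≤ _ := hqe x (by norm_num)
  have hrn : ∫ x, (μ.rnDeriv μ₀ x).toReal * H x ∂μ₀ = ∫ x, H x ∂μ := by
    simpa only [smul_eq_mul] using integral_rnDeriv_smul (f := H) hac
  have hrni : Integrable (fun x ↦ (μ.rnDeriv μ₀ x).toReal * H x) μ₀ := by
    simpa only [smul_eq_mul] using (integrable_rnDeriv_smul_iff (f := H) hac).2 hμ
  -- Fenchel–Young is applied pointwise with `t = λ H` and `ρ = dμ/dμ₀`. As `H` is centred, `λ H`
  -- can be subtracted for free, leaving the second-order remainder of the exponential; `λ K ≤ κ`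
  -- keeps it integrable.
  have key : lam * ∫ x, H x ∂μ ≤ r + lam ^ 2 * ∫ x, H x ^ 2 * expWeight κ x ∂μ₀ := by
    calc lam * ∫ x, H x ∂μ = ∫ x, lam * ((μ.rnDeriv μ₀ x).toReal * H x) ∂μ₀ := by
          rw [integral_const_mul, hrn]
      _ ≤ ∫ x, (klFun (μ.rnDeriv μ₀ x).toReal + (Real.exp (lam * H x) - 1)) ∂μ₀ := by
          refine integral_mono (hrni.const_mul _) (hkli.add hexp) fun x ↦ ?_
          have := mul_le_klFun_add_exp (lam * H x)
            (ENNReal.toReal_nonneg (a := μ.rnDeriv μ₀ x))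
          dsimp only
          linarith
      _ = ∫ x, klFun (μ.rnDeriv μ₀ x).toReal ∂μ₀
          + (∫ x, (Real.exp (lam * H x) - 1) ∂μ₀ - ∫ x, lam * H x ∂μ₀) := by
          rw [integral_add hkli hexp, integral_const_mul, hH0]; ring
      _ ≤ r + ∫ x, lam ^ 2 * (H x ^ 2 * expWeight κ x) ∂μ₀ := by
          rw [← integral_sub hexp (hHi.const_mul _)]
          refine add_le_add hklr (integral_mono (hexp.sub (hHi.const_mul _)) (hH2.const_mul _)
            fun x ↦ ?_)
          calc Real.exp (lam * H x) - 1 - lam * H x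
              ≤ (lam * H x) ^ 2 * Real.exp |lam * H x| := exp_sub_one_sub_self_le _
            _ ≤ (lam * H x) ^ 2 * expWeight κ x := by
                gcongr; exact Real.exp_le_exp.2 (hlam' x)
            _ = _ := by ring
      _ = _ := by rw [integral_const_mul]
  have h3 : r / lam + lam * ∫ x, H x ^ 2 * expWeight κ x ∂μ₀
      = (r + lam ^ 2 * ∫ x, H x ^ 2 * expWeight κ x ∂μ₀) / lam := by field_simp
  rw [h3, le_div_iff₀ hlam]; linarith

theorem abs_integral_le_of_klDiv_le [BorelSpace E] {μ₀ μ : Measure E}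
    [IsProbabilityMeasure μ₀] [IsProbabilityMeasure μ] {κ Q r : ℝ} (h₀ : HasExpMoment μ₀ κ Q)
    (hr : 0 ≤ r) (hkl : klDiv μ μ₀ ≤ ENNReal.ofReal r)
    {H : E → ℝ} (hH : AEStronglyMeasurable H μ₀) {K : ℝ} (hK : ∀ x, |H x| ≤ K * quadWeight x)
    (hH0 : ∫ x, H x ∂μ₀ = 0) (hμ : Integrable H μ) {lam : ℝ} (hlam : 0 < lam)
    (hlamK : lam * K ≤ κ) :
    |∫ x, H x ∂μ| ≤ r / lam + lam * ∫ x, H x ^ 2 * expWeight κ x ∂μ₀ := by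
  refine abs_le'.2 ⟨integral_le_of_klDiv_le h₀ hr hkl hH hK hH0 hμ hlam hlamK, ?_⟩
  have := integral_le_of_klDiv_le h₀ hr hkl (H := fun x ↦ -H x) hH.neg (K := K)
    (by simpa using hK) (by rw [integral_neg, hH0, neg_zero]) hμ.neg hlam hlamK
  simpa [integral_neg] using this

theorem integral_sq_mul_expWeight_le {μ₀ : Measure E} {κ Q : ℝ} (h₀ : HasExpMoment μ₀ κ Q)
    {H : E → ℝ} {K : ℝ} (hK : ∀ x, |H x| ≤ K * quadWeight x) :
    ∫ x, H x ^ 2 * expWeight κ x ∂μ₀ ≤ K ^ 2 * Q := by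
  refine h₀.integral_le_of_le (fun x ↦ mul_nonneg (sq_nonneg _) (expWeight_pos κ x).le)
    (sq_nonneg K) fun x ↦ ?_
  have h1 : H x ^ 2 ≤ K ^ 2 * quadWeight x ^ 3 := by
    calc H x ^ 2 = |H x| ^ 2 := (sq_abs _).symm
      _ ≤ (K * quadWeight x) ^ 2 := pow_le_pow_left₀ (abs_nonneg _) (hK x) 2
      _ = K ^ 2 * quadWeight x ^ 2 := by ring
      _ ≤ _ := by gcongr ?_ * ?_; exact pow_le_quadWeight_cube x (by norm_num)
  rw [← mul_assoc]
  exact mul_le_mul_of_nonneg_right h1 (expWeight_pos κ x).le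

/-- The choice `λ = κ √r / K` makes both terms of the transport inequality of order `K √r`. It is
admissible because `√r ≤ 1`. -/
theorem abs_integral_le_sqrt_of_klDiv_le [BorelSpace E] {μ₀ μ : Measure E}
    [IsProbabilityMeasure μ₀] [IsProbabilityMeasure μ] {κ Q r : ℝ} (h₀ : HasExpMoment μ₀ κ Q)
    (hr : 0 < r) (hr1 : r ≤ 1) (hkl : klDiv μ μ₀ ≤ ENNReal.ofReal r)
    {H : E → ℝ} (hH : AEStronglyMeasurable H μ₀) {K : ℝ} (hK0 : 0 ≤ K)
    (hK : ∀ x, |H x| ≤ K * quadWeight x)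
    (hH0 : ∫ x, H x ∂μ₀ = 0) (hμ : Integrable H μ) :
    |∫ x, H x ∂μ| ≤ (1 / κ + κ * Q) * K * √r := by
  rcases hK0.eq_or_lt with rfl | hKpos
  · have : H = 0 := by
      funext x; simpa using hK x
    simp [this]
  have hκ := h₀.pos
  have hs : 0 < √r := Real.sqrt_pos.2 hr
  have hs1 : √r ≤ 1 := Real.sqrt_le_one.2 hr1
  have hss : √r * √r = r := Real.mul_self_sqrt hr.le
  have h := abs_integral_le_of_klDiv_le h₀ hr.le hkl hH hK hH0 hμ
    (lam := κ * √r / K) (by positivity) (by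
      rw [div_mul_cancel₀ _ hKpos.ne']; nlinarith)
  refine h.trans ?_
  have h1 := integral_sq_mul_expWeight_le h₀ hK
  calc r / (κ * √r / K) + κ * √r / K * ∫ x, H x ^ 2 * expWeight κ x ∂μ₀
      ≤ r / (κ * √r / K) + κ * √r / K * (K ^ 2 * Q) := by gcongr
    _ = _ := by
      nth_rewrite 1 [← hss]
      field_simp

end Weight

/-! ### Averages over random signs. -/

section Signs

variable {n : ℕ}

/-- Expectation over `n` i.i.d. uniform signs. -/
def signMean (X : (Fin n → ℤˣ) → ℝ) : ℝ := (1 / (2 : ℝ) ^ n) * ∑ η, X η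

/-- The signed average `(1/n) ∑ᵢ ηᵢ aᵢ`. -/
def signAvg (η : Fin n → ℤˣ) (a : Fin n → ℝ) : ℝ := (1 / (n : ℝ)) * ∑ i, ((η i : ℤ) : ℝ) * a i

theorem signMean_mono {X Y : (Fin n → ℤˣ) → ℝ} (h : ∀ η, X η ≤ Y η) :
    signMean X ≤ signMean Y := by
  unfold signMean
  gcongr with η
  exact h η

theorem signMean_add (X Y : (Fin n → ℤˣ) → ℝ) :
    signMean (fun η ↦ X η + Y η) = signMean X + signMean Y := by
  simp only [signMean, Finset.sum_add_distrib, mul_add]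

theorem signMean_const_mul (c : ℝ) (X : (Fin n → ℤˣ) → ℝ) :
    signMean (fun η ↦ c * X η) = c * signMean X := by
  simp only [signMean, ← Finset.mul_sum]; ring

theorem signMean_const (c : ℝ) : signMean (fun _ : Fin n → ℤˣ ↦ c) = c := by
  simp only [signMean, Finset.sum_const, Finset.card_univ, Fintype.card_pi,
    Fintype.card_units_int, Finset.prod_const, Fintype.card_fin, nsmul_eq_mul]
  push_cast
  field_simp

theorem signMean_sum {ι : Type*} (s : Finset ι) (X : ι → (Fin n → ℤˣ) → ℝ) :
    signMean (fun η ↦ ∑ k ∈ s, X k η) = ∑ k ∈ s, signMean (X k) := by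
  simp only [signMean]
  rw [Finset.sum_comm, Finset.mul_sum]

theorem signMean_integral {α : Type*} [MeasurableSpace α] {μ : Measure α}
    {F : (Fin n → ℤˣ) → α → ℝ} (hF : ∀ η, Integrable (F η) μ) :
    signMean (fun η ↦ ∫ x, F η x ∂μ) = ∫ x, signMean (fun η ↦ F η x) ∂μ := by
  simp only [signMean]
  rw [integral_const_mul, integral_finsetSum _ fun η _ ↦ hF η]

theorem sum_units_int (f : ℤˣ → ℝ) : ∑ u, f u = f 1 + f (-1) := by
  have : (Finset.univ : Finset ℤˣ) = {1, -1} := rfl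
  rw [this, Finset.sum_pair (by decide)]

/-- Independence of the signs, as the expansion of a product of sums. Both the covariances and the
exponential moments of the signs come from it. -/
theorem signMean_prod (f : Fin n → ℤˣ → ℝ) :
    signMean (fun η ↦ ∏ i, f i (η i)) = ∏ i, ((f i 1 + f i (-1)) / 2) := by
  have h := Finset.prod_univ_sum (fun _ : Fin n ↦ (Finset.univ : Finset ℤˣ)) f
  rw [Fintype.piFinset_univ] at h
  simp only [signMean]
  rw [← h, Finset.prod_div_distrib]
  simp only [sum_units_int, Finset.prod_const, Finset.card_univ, Fintype.card_fin]
  ring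

theorem signMean_mul_self (i j : Fin n) :
    signMean (fun η : Fin n → ℤˣ ↦ ((η i : ℤ) : ℝ) * ((η j : ℤ) : ℝ)) = if i = j then 1 else 0 := by
  have h : (fun η : Fin n → ℤˣ ↦ ((η i : ℤ) : ℝ) * ((η j : ℤ) : ℝ)) = fun η ↦
      ∏ k, (fun k (u : ℤˣ) ↦ (if k = i then ((u : ℤ) : ℝ) else 1) *
        (if k = j then ((u : ℤ) : ℝ) else 1)) k (η k) := by
    funext η
    simp only [Finset.prod_mul_distrib, Finset.prod_ite_eq', Finset.mem_univ, if_true]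
  rw [h, signMean_prod fun k (u : ℤˣ) ↦ (if k = i then ((u : ℤ) : ℝ) else 1) *
    (if k = j then ((u : ℤ) : ℝ) else 1)]
  split_ifs with hij
  · subst hij
    refine Finset.prod_eq_one fun k _ ↦ ?_
    by_cases hk : k = i <;> simp [hk]
  · refine Finset.prod_eq_zero (Finset.mem_univ i) ?_
    simp [hij]

theorem signMean_signAvg_sq (a : Fin n → ℝ) :
    signMean (fun η ↦ signAvg η a ^ 2) = (1 / (n : ℝ)) ^ 2 * ∑ i, a i ^ 2 := by
  have h : (fun η : Fin n → ℤˣ ↦ signAvg η a ^ 2) = fun η ↦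
      (1 / (n : ℝ)) ^ 2 * ∑ i, ∑ j, (a i * a j) * (((η i : ℤ) : ℝ) * ((η j : ℤ) : ℝ)) := by
    funext η
    simp only [signAvg, mul_pow]
    congr 1
    rw [sq, Finset.sum_mul_sum]
    refine Finset.sum_congr rfl fun i _ ↦ Finset.sum_congr rfl fun j _ ↦ by ring
  rw [h, signMean_const_mul, signMean_sum]
  congr 1
  refine Finset.sum_congr rfl fun i _ ↦ ?_
  rw [signMean_sum]
  simp only [signMean_const_mul, signMean_mul_self, mul_ite, mul_one, mul_zero,
    Finset.sum_ite_eq, Finset.mem_univ, if_true]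
  ring

theorem signMean_signAvg_sq_le (hn : 0 < n) {a : Fin n → ℝ} {B : ℝ} (ha : ∀ i, |a i| ≤ B) :
    signMean (fun η ↦ signAvg η a ^ 2) ≤ B ^ 2 / n := by
  rw [signMean_signAvg_sq]
  have hn' : (0 : ℝ) < n := by exact_mod_cast hn
  have : ∑ i, a i ^ 2 ≤ n * B ^ 2 := by
    calc ∑ i, a i ^ 2 ≤ ∑ _i : Fin n, B ^ 2 :=
          Finset.sum_le_sum fun i _ ↦ by
            rw [← sq_abs]; exact pow_le_pow_left₀ (abs_nonneg _) (ha i) 2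
      _ = _ := by simp
  calc (1 / (n : ℝ)) ^ 2 * ∑ i, a i ^ 2 ≤ (1 / (n : ℝ)) ^ 2 * (n * B ^ 2) := by gcongr
    _ = _ := by field_simp

theorem signMean_exp_le (a : Fin n → ℝ) :
    signMean (fun η ↦ Real.exp (∑ i, ((η i : ℤ) : ℝ) * a i)) ≤ Real.exp (∑ i, a i ^ 2 / 2) := by
  simp only [Real.exp_sum]
  rw [signMean_prod fun i u ↦ Real.exp (((u : ℤ) : ℝ) * a i)]
  refine Finset.prod_le_prod (fun i _ ↦ by positivity) fun i _ ↦ ?_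
  refine le_trans (le_of_eq ?_) (Real.cosh_le_exp_half_sq (a i))
  rw [Real.cosh_eq]; simp

theorem abs_sign (u : ℤˣ) : |((u : ℤ) : ℝ)| = 1 := by
  rcases Int.units_eq_one_or u with rfl | rfl <;> simp

theorem abs_signAvg_le (hn : 0 < n) (η : Fin n → ℤˣ) {a : Fin n → ℝ} {B : ℝ}
    (ha : ∀ i, |a i| ≤ B) : |signAvg η a| ≤ B := by
  have hn' : (0 : ℝ) < n := by exact_mod_cast hn
  unfold signAvg
  rw [abs_mul, abs_of_pos (by positivity : (0 : ℝ) < 1 / n)]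
  have : |∑ i, ((η i : ℤ) : ℝ) * a i| ≤ n * B := by
    refine (Finset.abs_sum_le_sum_abs _ _).trans ?_
    calc ∑ i, |((η i : ℤ) : ℝ) * a i| ≤ ∑ _i : Fin n, B :=
          Finset.sum_le_sum fun i _ ↦ by rw [abs_mul, abs_sign, one_mul]; exact ha i
      _ = _ := by simp
  calc 1 / (n : ℝ) * |∑ i, ((η i : ℤ) : ℝ) * a i| ≤ 1 / (n : ℝ) * (n * B) := by gcongr
    _ = B := by field_simp

theorem signAvg_add (η : Fin n → ℤˣ) (a b : Fin n → ℝ) :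
    signAvg η (fun i ↦ a i + b i) = signAvg η a + signAvg η b := by
  simp only [signAvg, mul_add, Finset.sum_add_distrib]

theorem signAvg_sub (η : Fin n → ℤˣ) (a b : Fin n → ℝ) :
    signAvg η (fun i ↦ a i - b i) = signAvg η a - signAvg η b := by
  simp only [signAvg, mul_sub, Finset.sum_sub_distrib]

theorem signAvg_const_mul (η : Fin n → ℤˣ) (c : ℝ) (a : Fin n → ℝ) :
    signAvg η (fun i ↦ c * a i) = c * signAvg η a := by
  simp only [signAvg, mul_left_comm _ c, ← Finset.mul_sum]

/-- Massart's finite class lemma. -/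
theorem signMean_iSup_le {ι : Type*} [Fintype ι] [Nonempty ι] (hn : 0 < n) {A : ι → Fin n → ℝ}
    (hA : ∀ k i, |A k i| ≤ 1) {lam : ℝ} (hlam : 0 < lam) :
    signMean (fun η ↦ ⨆ k, signAvg η (A k)) ≤ Real.log (Fintype.card ι) / (lam * n) + lam / 2 := by
  have hn' : (0 : ℝ) < n := by exact_mod_cast hn
  have hc : (0 : ℝ) < Fintype.card ι := by exact_mod_cast Fintype.card_pos
  set S : ℝ := Real.log (Fintype.card ι) + lam ^ 2 * n / 2 with hS
  -- Jensen is replaced by the tangent line `y ≤ (S - 1) + exp (y - S)`, with `S` the logarithm of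
  -- the bound for the summed exponential moments.
  have hpt : ∀ η : Fin n → ℤˣ, lam * n * (⨆ k, signAvg η (A k)) ≤
      (S - 1) + Real.exp (-S) * ∑ k, Real.exp (∑ i, ((η i : ℤ) : ℝ) * (lam * A k i)) := by
    intro η
    obtain ⟨k, hk⟩ := exists_eq_ciSup_of_finite (f := fun k ↦ signAvg η (A k))
    rw [← hk]
    have h1 : lam * n * signAvg η (A k) = ∑ i, ((η i : ℤ) : ℝ) * (lam * A k i) := by
      simp only [signAvg, mul_left_comm _ lam, ← Finset.mul_sum]
      field_simp
    have h2 := Real.add_one_le_exp (lam * n * signAvg η (A k) - S)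
    have h3 : Real.exp (lam * n * signAvg η (A k) - S) ≤
        Real.exp (-S) * ∑ k, Real.exp (∑ i, ((η i : ℤ) : ℝ) * (lam * A k i)) := by
      rw [sub_eq_neg_add, Real.exp_add, h1]
      gcongr
      exact Finset.single_le_sum (f := fun k ↦ Real.exp (∑ i, ((η i : ℤ) : ℝ) * (lam * A k i)))
        (fun _ _ ↦ (Real.exp_pos _).le) (Finset.mem_univ k)
    linarith
  have hmean := signMean_mono hpt
  rw [signMean_const_mul, signMean_add, signMean_const, signMean_const_mul, signMean_sum] at hmean
  have hexp : ∑ k, signMean (fun η ↦ Real.exp (∑ i, ((η i : ℤ) : ℝ) * (lam * A k i))) ≤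
      Real.exp S := by
    calc _ ≤ ∑ _k : ι, Real.exp (lam ^ 2 * n / 2) := by
          refine Finset.sum_le_sum fun k _ ↦ (signMean_exp_le _).trans (Real.exp_le_exp.2 ?_)
          calc ∑ i, (lam * A k i) ^ 2 / 2 ≤ ∑ _i : Fin n, lam ^ 2 / 2 := by
                refine Finset.sum_le_sum fun i _ ↦ ?_
                have : A k i ^ 2 ≤ 1 := by
                  rw [← sq_abs]; exact pow_le_one₀ (abs_nonneg _) (hA k i)
                rw [mul_pow]
                nlinarith [sq_nonneg lam]
            _ = _ := by simp; ring
      _ = Real.exp S := by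
          rw [hS, Real.exp_add, Real.exp_log hc]; simp
  have h4 : Real.exp (-S) * Real.exp S = 1 := by rw [← Real.exp_add]; simp
  have h5 : lam * n * signMean (fun η ↦ ⨆ k, signAvg η (A k)) ≤ S := by
    nlinarith [Real.exp_pos (-S)]
  have h6 : Real.log (Fintype.card ι) / (lam * n) + lam / 2 = S / (lam * n) := by
    rw [hS]; field_simp
  rw [h6, le_div_iff₀ (by positivity)]
  linarith

/-- The average is linear in `φ`, so over the box `|φ| ≤ B` it is extremal at a vertex. Grouping
indices by label, the vertex takes the sign of each group's sum. This trades a continuum of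
functions for finitely many sign patterns. -/
theorem exists_signs_abs_signAvg_le {P : Type*} [Fintype P] [DecidableEq P] (η : Fin n → ℤˣ)
    (l : Fin n → P) {φ : P → ℝ} {B : ℝ} (hφ : ∀ p, |φ p| ≤ B) :
    ∃ ε : P → ℤˣ, |signAvg η (fun i ↦ φ (l i))| ≤ B * signAvg η (fun i ↦ ((ε (l i) : ℤ) : ℝ)) := by
  have hfib : ∀ ψ : P → ℝ, ∑ i, ((η i : ℤ) : ℝ) * ψ (l i) =
      ∑ p, ψ p * ∑ i with l i = p, ((η i : ℤ) : ℝ) := by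
    intro ψ
    rw [← Finset.sum_fiberwise Finset.univ l]
    refine Finset.sum_congr rfl fun p _ ↦ ?_
    rw [Finset.mul_sum]
    refine Finset.sum_congr rfl fun i hi ↦ ?_
    rw [(Finset.mem_filter.1 hi).2, mul_comm]
  set S : P → ℝ := fun p ↦ ∑ i with l i = p, ((η i : ℤ) : ℝ) with hSdef
  refine ⟨fun p ↦ if 0 ≤ S p then 1 else -1, ?_⟩
  have hn' : (0 : ℝ) ≤ 1 / (n : ℝ) := by positivity
  unfold signAvg
  rw [hfib φ, hfib fun p ↦ (((if 0 ≤ S p then 1 else -1 : ℤˣ) : ℤ) : ℝ), abs_mul,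
    abs_of_nonneg hn', mul_left_comm]
  gcongr
  refine (Finset.abs_sum_le_sum_abs _ _).trans ?_
  rw [Finset.mul_sum]
  refine Finset.sum_le_sum fun p _ ↦ ?_
  have : (((if 0 ≤ S p then 1 else -1 : ℤˣ) : ℤ) : ℝ) * S p = |S p| := by
    split_ifs with h
    · simp [abs_of_nonneg h]
    · simp [abs_of_neg (not_le.1 h)]
  rw [this, abs_mul]
  exact mul_le_mul_of_nonneg_right (hφ p) (abs_nonneg _)

end Signs

/-! ### A uniform law for ridge functions by discretization. -/

section RidgeClass

variable {d n : ℕ}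

theorem abs_coord_le_norm (x : Feat d) (j : Fin d) : |x j| ≤ ‖x‖ := by
  simpa using PiLp.norm_apply_le x j

theorem inner_eq_sum (w x : Feat d) : ⟪w, x⟫ = ∑ j, w j * x j := by
  simp [PiLp.inner_apply, mul_comm]

/-- The integer part of `∑ⱼ kⱼ xⱼ + c` is bounded in terms of the size of the grid. -/
theorem gridCell_mem {m : ℕ} {x : Feat d} (hx : ‖x‖ ≤ 1)
    (k : Fin d → Finset.Icc (-(m : ℤ)) m) (c : Finset.Icc (-(m : ℤ)) m) :
    ⌊∑ j, ((k j : ℤ) : ℝ) * x j + ((c : ℤ) : ℝ)⌋ ∈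
      Finset.Icc (-(((d + 1) * m : ℕ) : ℤ)) (((d + 1) * m : ℕ) : ℤ) := by
  have hb : ∀ p : Finset.Icc (-(m : ℤ)) m, |((p : ℤ) : ℝ)| ≤ m := fun p ↦ by
    have h := Finset.mem_Icc.1 p.2
    rw [abs_le]
    exact ⟨by exact_mod_cast h.1, by exact_mod_cast h.2⟩
  have h1 : |∑ j, ((k j : ℤ) : ℝ) * x j + ((c : ℤ) : ℝ)| ≤ (((d + 1) * m : ℕ) : ℝ) := by
    refine (abs_add_le _ _).trans ?_
    have h2 : |∑ j, ((k j : ℤ) : ℝ) * x j| ≤ d * m := by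
      refine (Finset.abs_sum_le_sum_abs _ _).trans ?_
      calc ∑ j, |((k j : ℤ) : ℝ) * x j| ≤ ∑ _j : Fin d, (m : ℝ) := by
            refine Finset.sum_le_sum fun j _ ↦ ?_
            rw [abs_mul]
            have := (abs_coord_le_norm x j).trans hx
            nlinarith [hb (k j), abs_nonneg (((k j : ℤ) : ℝ)), abs_nonneg (x j)]
        _ = d * m := by simp
    have := hb c
    push_cast
    linarith
  obtain ⟨h3, h4⟩ := abs_le.1 h1
  rw [Finset.mem_Icc]
  constructor
  · rw [Int.le_floor]; exact_mod_cast h3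
  · have := (Int.floor_le (∑ j, ((k j : ℤ) : ℝ) * x j + ((c : ℤ) : ℝ))).trans h4
    exact_mod_cast this

theorem floor_mem_grid (m : ℕ) {t : ℝ} (ht : |t| ≤ 1) :
    ⌊m * t⌋ ∈ Finset.Icc (-(m : ℤ)) m := by
  obtain ⟨h1, h2⟩ := abs_le.1 ht
  have hm : (0 : ℝ) ≤ m := by positivity
  rw [Finset.mem_Icc]
  constructor
  · rw [Int.le_floor]; push_cast; nlinarith
  · have : (⌊(m : ℝ) * t⌋ : ℝ) ≤ m := (Int.floor_le _).trans (by nlinarith)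
    exact_mod_cast this

theorem abs_sub_floor_le (t : ℝ) : |t - ⌊t⌋| ≤ 1 := by
  rw [abs_le]
  constructor <;> linarith [Int.floor_le t, Int.lt_floor_add_one t]

/-- Finite discretization of the class of normalized ridge functions. -/
theorem exists_abs_signAvg_ridge_le {σ : ℝ → ℝ} {L : ℝ} (hL : 0 ≤ L)
    (hlip : ∀ s t, |σ s - σ t| ≤ L * |s - t|) (hgrowth : ∀ t, |σ t| ≤ L * (1 + |t|))
    (hn : 0 < n) {x : Fin n → Feat d} (hx : ∀ i, ‖x i‖ ≤ 1) {m : ℕ} (hm : 0 < m)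
    (η : Fin n → ℤˣ) (w : Feat d) (b : ℝ) :
    ∃ (k : Fin d → Finset.Icc (-(m : ℤ)) m) (c : Finset.Icc (-(m : ℤ)) m)
      (ε : Finset.Icc (-(((d + 1) * m : ℕ) : ℤ)) (((d + 1) * m : ℕ) : ℤ) → ℤˣ),
      |signAvg η (fun i ↦ σ (⟪w, x i⟫ + b))| ≤ L * (d + 2) *
        (1 / m + signAvg η (fun i ↦ ((ε ⟨_, gridCell_mem (hx i) k c⟩ : ℤ) : ℝ))) *
          (1 + ‖w‖ + |b|) := by
  have hm' : (0 : ℝ) < m := by exact_mod_cast hm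
  -- Dividing by `N` brings `(w, b)` into the unit box, which a finite grid of mesh `1/m` covers.
  set N : ℝ := 1 + ‖w‖ + |b| with hN
  have hN1 : 1 ≤ N := by rw [hN]; linarith [norm_nonneg w, abs_nonneg b]
  have hN0 : 0 < N := by linarith
  have hwN : ∀ j, |w j / N| ≤ 1 := fun j ↦ by
    rw [abs_div, abs_of_pos hN0, div_le_one hN0]
    linarith [abs_coord_le_norm w j, abs_nonneg b]
  have hbN : |b / N| ≤ 1 := by
    rw [abs_div, abs_of_pos hN0, div_le_one hN0]
    linarith [norm_nonneg w]
  let k : Fin d → Finset.Icc (-(m : ℤ)) m := fun j ↦ ⟨_, floor_mem_grid m (hwN j)⟩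
  let c : Finset.Icc (-(m : ℤ)) m := ⟨_, floor_mem_grid m hbN⟩
  let l : Fin n → Finset.Icc (-(((d + 1) * m : ℕ) : ℤ)) (((d + 1) * m : ℕ) : ℤ) :=
    fun i ↦ ⟨_, gridCell_mem (hx i) k c⟩
  have hφ : ∀ p : Finset.Icc (-(((d + 1) * m : ℕ) : ℤ)) (((d + 1) * m : ℕ) : ℤ),
      |σ (N * (p : ℤ) / m)| ≤ L * (d + 2) * N := by
    intro p
    have hp : |((p : ℤ) : ℝ)| ≤ (d + 1) * m := by
      have h := Finset.mem_Icc.1 p.2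
      rw [abs_le]
      exact ⟨by exact_mod_cast h.1, by exact_mod_cast h.2⟩
    have h1 : |N * ((p : ℤ) : ℝ) / m| ≤ N * (d + 1) := by
      rw [abs_div, abs_mul, abs_of_pos hN0, abs_of_pos hm', div_le_iff₀ hm']
      nlinarith
    calc |σ (N * (p : ℤ) / m)| ≤ L * (1 + |N * (p : ℤ) / m|) := hgrowth _
      _ ≤ L * (N + N * (d + 1)) := by gcongr
      _ = _ := by ring
  obtain ⟨ε, hε⟩ := exists_signs_abs_signAvg_le η l hφ
  refine ⟨k, c, ε, ?_⟩
  -- The factor `d + 2` counts rounding errors of size one: `d` coordinates of `w`, the bias, and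
  -- the final integer part.
  have herr : ∀ i, |σ (⟪w, x i⟫ + b) - σ (N * (l i : ℤ) / m)| ≤ L * (d + 2) * N / m := by
    intro i
    refine (hlip _ _).trans ?_
    set T : ℝ := ∑ j, ((k j : ℤ) : ℝ) * x i j + ((c : ℤ) : ℝ) with hT
    have h1 : |m * ((⟪w, x i⟫ + b) / N) - T| ≤ d + 1 := by
      have h2 : m * ((⟪w, x i⟫ + b) / N) - T =
          ∑ j, (m * (w j / N) - ⌊m * (w j / N)⌋) * x i j + (m * (b / N) - ⌊m * (b / N)⌋) := by
        simp only [sub_mul, Finset.sum_sub_distrib, hT, k, c, inner_eq_sum]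
        rw [add_div, mul_add, Finset.sum_div, Finset.mul_sum]
        have : ∀ j, (m : ℝ) * (w j * x i j / N) = m * (w j / N) * x i j := fun j ↦ by ring
        simp only [this]
        ring
      rw [h2]
      refine (abs_add_le _ _).trans (add_le_add ?_ (abs_sub_floor_le _))
      refine (Finset.abs_sum_le_sum_abs _ _).trans ?_
      calc _ ≤ ∑ _j : Fin d, (1 : ℝ) := by
            refine Finset.sum_le_sum fun j _ ↦ ?_
            rw [abs_mul]
            exact mul_le_one₀ (abs_sub_floor_le _) (abs_nonneg _)
              ((abs_coord_le_norm _ j).trans (hx i))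
        _ = d := by simp
    have h3 : |T - ((l i : ℤ) : ℝ)| ≤ 1 := abs_sub_floor_le T
    have h4 : |m * ((⟪w, x i⟫ + b) / N) - ((l i : ℤ) : ℝ)| ≤ d + 2 := by
      have := abs_sub_le (m * ((⟪w, x i⟫ + b) / N)) T ((l i : ℤ) : ℝ)
      linarith
    have h5 : ⟪w, x i⟫ + b - N * (l i : ℤ) / m =
        N / m * (m * ((⟪w, x i⟫ + b) / N) - ((l i : ℤ) : ℝ)) := by
      field_simp
    rw [h5, abs_mul, abs_of_pos (by positivity : 0 < N / m)]
    calc L * (N / m * |m * ((⟪w, x i⟫ + b) / N) - ((l i : ℤ) : ℝ)|) ≤ L * (N / m * (d + 2)) := by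
          gcongr
      _ = _ := by ring
  have hsplit : signAvg η (fun i ↦ σ (⟪w, x i⟫ + b)) =
      signAvg η (fun i ↦ σ (⟪w, x i⟫ + b) - σ (N * (l i : ℤ) / m)) +
        signAvg η (fun i ↦ σ (N * (l i : ℤ) / m)) := by
    rw [signAvg_sub]; ring
  rw [hsplit]
  refine (abs_add_le _ _).trans ((add_le_add (abs_signAvg_le hn η herr) hε).trans (le_of_eq ?_))
  simp only [l]
  ring

/-- Uniform law for ridge functions, relative to `1 + ‖w‖ + |b|`, at the rate `n ^ (-1/4)`. -/
theorem exists_ridge_envelope {σ : ℝ → ℝ} {L : ℝ} (hL : 0 ≤ L)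
    (hlip : ∀ s t, |σ s - σ t| ≤ L * |s - t|) (hgrowth : ∀ t, |σ t| ≤ L * (1 + |t|))
    (hn : 0 < n) {x : Fin n → Feat d} (hx : ∀ i, ‖x i‖ ≤ 1) :
    ∃ K : (Fin n → ℤˣ) → ℝ, (∀ η, 0 ≤ K η) ∧
      (∀ η w b, |signAvg η (fun i ↦ σ (⟪w, x i⟫ + b))| ≤ K η * (1 + ‖w‖ + |b|)) ∧
      signMean K ≤ L * (d + 2) * (8 * d + 12) / √(√n) := by
  have hn' : (1 : ℝ) ≤ n := by exact_mod_cast hn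
  set ρ : ℝ := √(√n) with hρ
  have hρ1 : 1 ≤ ρ := Real.one_le_sqrt.2 (Real.one_le_sqrt.2 hn')
  have hρ0 : 0 < ρ := by linarith
  have hρ4 : ρ ^ 4 = (n : ℝ) := by
    calc ρ ^ 4 = (ρ ^ 2) ^ 2 := by ring
      _ = (n : ℝ) := by rw [hρ, Real.sq_sqrt (by positivity), Real.sq_sqrt (by positivity)]
  -- With `ρ = n^(1/4)`, the mesh error `1/m` has exactly the target rate.
  set m : ℕ := ⌈ρ⌉₊ with hm
  have hm0 : 0 < m := Nat.ceil_pos.2 hρ0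
  have hmρ : ρ ≤ m := Nat.le_ceil ρ
  have hm2 : (m : ℝ) ≤ 2 * ρ := by linarith [Nat.ceil_lt_add_one hρ0.le]
  have hm' : (0 : ℝ) < m := by linarith
  let ι := (Fin d → Finset.Icc (-(m : ℤ)) m) × Finset.Icc (-(m : ℤ)) m ×
    (Finset.Icc (-(((d + 1) * m : ℕ) : ℤ)) (((d + 1) * m : ℕ) : ℤ) → ℤˣ)
  have hne : Nonempty (Finset.Icc (-(m : ℤ)) m) := ⟨⟨0, by simp⟩⟩
  have hιne : Nonempty ι := inferInstance
  let A : ι → Fin n → ℝ := fun p i ↦ ((p.2.2 ⟨_, gridCell_mem (hx i) p.1 p.2.1⟩ : ℤ) : ℝ)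
  let K : (Fin n → ℤˣ) → ℝ := fun η ↦ L * (d + 2) * (1 / m + ⨆ p, signAvg η (A p))
  have hbound : ∀ η w b,
      |signAvg η (fun i ↦ σ (⟪w, x i⟫ + b))| ≤ K η * (1 + ‖w‖ + |b|) := by
    intro η w b
    obtain ⟨k, c, ε, h⟩ := exists_abs_signAvg_ridge_le hL hlip hgrowth hn hx hm0 η w b
    refine h.trans ?_
    simp only [K]
    gcongr
    exact le_ciSup (f := fun p ↦ signAvg η (A p)) (Set.finite_range _).bddAbove (k, c, ε)
  refine ⟨K, fun η ↦ ?_, hbound, ?_⟩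
  · simpa using (abs_nonneg _).trans (hbound η 0 0)
  -- The cell labels are integers in a range of length proportional to `m`, so even with all sign
  -- patterns on them the log-cardinality is linear in `m`.
  · have hlog : Real.log (Fintype.card ι) ≤ (4 * d + 5) * m := by
      have hcard : (Fintype.card ι : ℝ) =
          (2 * m + 1 : ℝ) ^ (d + 1) * 2 ^ (2 * ((d + 1) * m) + 1) := by
        have h1 : ∀ M : ℕ, Fintype.card (Finset.Icc (-(M : ℤ)) M) = 2 * M + 1 := fun M ↦ by
          rw [Fintype.card_coe, Int.card_Icc]; omega
        simp only [ι, Fintype.card_prod, Fintype.card_pi, Finset.prod_const, Finset.card_univ, h1,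
          Fintype.card_units_int, Fintype.card_fin]
        push_cast
        ring
      rw [hcard, Real.log_mul (by positivity) (by positivity), Real.log_pow, Real.log_pow]
      have h2 : Real.log (2 * m + 1 : ℝ) ≤ 2 * m := by
        have := Real.log_le_sub_one_of_pos (by positivity : (0 : ℝ) < 2 * m + 1)
        linarith
      have h3 : Real.log 2 ≤ 1 := by
        have := Real.log_le_sub_one_of_pos (by norm_num : (0 : ℝ) < 2); linarith
      push_cast
      calc ((d : ℝ) + 1) * Real.log (2 * m + 1) + (2 * ((d + 1) * m) + 1) * Real.log 2
          ≤ ((d : ℝ) + 1) * (2 * m) + (2 * ((d + 1) * m) + 1) * 1 := by gcongr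
        _ ≤ _ := by nlinarith
    -- For `λ = 1/ρ` the entropy term is of order `ρ · ρ / ρ⁴ = ρ⁻²`, below the mesh error `ρ⁻¹`, so
    -- no finer tuning is needed.
    have hmass := signMean_iSup_le hn (A := A) (fun k i ↦ (abs_sign _).le)
      (lam := 1 / ρ) (by positivity)
    have h1 : signMean (fun η ↦ ⨆ p, signAvg η (A p)) ≤ (8 * d + 11) / ρ := by
      refine hmass.trans ?_
      have h2 : Real.log (Fintype.card ι) / (1 / ρ * n) ≤ (8 * d + 10) / ρ := by
        rw [← hρ4, div_le_div_iff₀ (by positivity) hρ0]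
        have h3 : Real.log (Fintype.card ι) ≤ (8 * d + 10) * ρ := by
          refine hlog.trans ?_
          nlinarith
        have h4 : (8 * (d : ℝ) + 10) * (1 / ρ * ρ ^ 4) = (8 * d + 10) * ρ ^ 2 * ρ := by
          field_simp
        rw [h4]
        gcongr
        refine h3.trans ?_
        gcongr
        nlinarith
      have h3 : (8 * d + 11) / ρ = (8 * d + 10) / ρ + 1 / ρ := by ring
      have h4 : 1 / ρ / 2 ≤ 1 / ρ := by
        have : 0 < 1 / ρ := by positivity
        linarith
      linarith
    simp only [K]
    rw [signMean_const_mul, signMean_add, signMean_const]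
    have h5 : 1 / (m : ℝ) ≤ 1 / ρ := by gcongr
    calc L * (d + 2) * (1 / m + signMean fun η ↦ ⨆ p, signAvg η (A p))
        ≤ L * (d + 2) * (1 / ρ + (8 * d + 11) / ρ) := by gcongr
      _ = _ := by ring

end RidgeClass

/-! ### Lipschitz, growth and Taylor bounds for the activation. -/

section Activation

variable {L : ℝ} {σ : ℝ → ℝ}

theorem IsActivation.mono {L' : ℝ} (h : IsActivation L σ) (hLL' : L ≤ L') : IsActivation L' σ where
  differentiable := h.differentiable
  differentiable_deriv := h.differentiable_deriv
  growth x := (h.growth x).trans (by gcongr)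
  deriv_le x := (h.deriv_le x).trans hLL'
  deriv2_le x := (h.deriv2_le x).trans hLL'

theorem IsActivation.nonneg (h : IsActivation L σ) : 0 ≤ L := (abs_nonneg _).trans (h.deriv_le 0)

theorem IsActivation.abs_sub_le (h : IsActivation L σ) (s t : ℝ) : |σ s - σ t| ≤ L * |s - t| := by
  simpa [Real.norm_eq_abs] using convex_univ.norm_image_sub_le_of_norm_deriv_le (f := σ) (C := L)
    (fun x _ ↦ h.differentiable x) (fun x _ ↦ h.deriv_le x) (mem_univ t) (mem_univ s)

theorem IsActivation.abs_le (h : IsActivation L σ) (t : ℝ) : |σ t| ≤ L * (1 + |t|) := by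
  refine (h.growth t).trans (mul_le_mul_of_nonneg_left ?_ h.nonneg)
  exact max_le (by linarith) (by linarith [abs_nonneg t])

theorem IsActivation.abs_deriv_sub_le (h : IsActivation L σ) (s t : ℝ) :
    |deriv σ s - deriv σ t| ≤ L * |s - t| := by
  simpa [Real.norm_eq_abs] using convex_univ.norm_image_sub_le_of_norm_deriv_le (f := deriv σ)
    (C := L) (fun x _ ↦ h.differentiable_deriv x) (fun x _ ↦ h.deriv2_le x) (mem_univ t)
    (mem_univ s)

theorem IsActivation.abs_taylor_le (h : IsActivation L σ) (t e : ℝ) :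
    |σ (t + e) - σ t - deriv σ t * e| ≤ L * e ^ 2 := by
  have hd : ∀ s, HasDerivAt (fun s ↦ σ s - deriv σ t * s) (deriv σ s - deriv σ t) s := fun s ↦
    ((h.differentiable s).hasDerivAt.fun_sub
      ((hasDerivAt_id' s).const_mul (deriv σ t))).congr_deriv (by rw [mul_one])
  have hmv := (convex_uIcc t (t + e)).norm_image_sub_le_of_norm_hasDerivWithin_le
    (f := fun s ↦ σ s - deriv σ t * s) (C := L * |e|) (fun s _ ↦ (hd s).hasDerivWithinAt)
    (fun s hs ↦ by
      refine (h.abs_deriv_sub_le s t).trans (mul_le_mul_of_nonneg_left ?_ h.nonneg)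
      simpa using abs_sub_left_of_mem_uIcc hs)
    left_mem_uIcc right_mem_uIcc
  have h1 : σ (t + e) - deriv σ t * (t + e) - (σ t - deriv σ t * t) =
      σ (t + e) - σ t - deriv σ t * e := by ring
  simp only [h1, add_sub_cancel_left, Real.norm_eq_abs] at hmv
  calc _ ≤ L * |e| * |e| := hmv
    _ = _ := by rw [mul_assoc, abs_mul_abs_self, sq]

theorem IsActivation.continuous (h : IsActivation L σ) : Continuous σ := h.differentiable.continuous

theorem IsActivation.continuous_deriv (h : IsActivation L σ) : Continuous (deriv σ) :=
  h.differentiable_deriv.continuous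

theorem IsActivation.abs_neuron_le (h : IsActivation L σ) {E : Type*} [NormedAddCommGroup E]
    [InnerProductSpace ℝ E] (w z : E) (b : ℝ) :
    |σ (⟪w, z⟫ + b)| ≤ L * ((1 + ‖z‖) * (1 + ‖w‖ + |b|)) := by
  refine (h.abs_le _).trans (mul_le_mul_of_nonneg_left ?_ h.nonneg)
  have h1 := abs_add_le ⟪w, z⟫ b
  have h2 := abs_real_inner_le_norm w z
  nlinarith [norm_nonneg w, norm_nonneg z, abs_nonneg b,
    mul_nonneg (norm_nonneg z) (abs_nonneg b)]

theorem IsActivation.abs_neuron_le_of_norm_le_one (h : IsActivation L σ) {E : Type*}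
    [NormedAddCommGroup E] [InnerProductSpace ℝ E] (w : E) {z : E} (hz : ‖z‖ ≤ 1) (b : ℝ) :
    |σ (⟪w, z⟫ + b)| ≤ L * (1 + ‖w‖ + |b|) := by
  refine (h.abs_le _).trans (mul_le_mul_of_nonneg_left ?_ h.nonneg)
  have h1 := abs_add_le ⟪w, z⟫ b
  have h2 := abs_real_inner_le_norm w z
  nlinarith [norm_nonneg w, norm_nonneg z]

end Activation

/-! ### Drift and trajectories inside the relative-entropy ball. -/

section Params

variable {d : ℕ}

theorem LayerP2.integrable_quadWeight {μ : Measure (LayerParam d)} (h : LayerP2 μ) :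
    Integrable quadWeight μ := by
  have := h.1
  refine ((integrable_const (1 : ℝ)).add h.2).mono' (by fun_prop) (ae_of_all _ fun θ ↦ ?_)
  rw [Real.norm_of_nonneg (quadWeight_pos θ).le]
  have h1 : ‖θ‖ = max ‖θ.1‖ (max ‖θ.2.1‖ |θ.2.2|) := rfl
  simp only [quadWeight, h1, Pi.add_apply]
  have h3 := sq_abs θ.2.2
  rcases max_choice ‖θ.1‖ (max ‖θ.2.1‖ |θ.2.2|) with h2 | h2 <;> rw [h2]
  · nlinarith [sq_nonneg ‖θ.2.1‖, sq_nonneg θ.2.2]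
  · rcases max_choice ‖θ.2.1‖ |θ.2.2| with h2 | h2 <;> rw [h2] <;>
      nlinarith [sq_nonneg ‖θ.2.1‖, sq_nonneg θ.2.2, sq_nonneg ‖θ.1‖]

theorem OutP2.integrable_quadWeight {μ : Measure (OutParam d)} (h : OutP2 μ) :
    Integrable quadWeight μ := by
  have := h.1
  refine ((integrable_const (1 : ℝ)).add h.2).mono' (by fun_prop) (ae_of_all _ fun θ ↦ ?_)
  rw [Real.norm_of_nonneg (quadWeight_pos θ).le]
  have h1 : ‖θ‖ = max |θ.1| (max ‖θ.2.1‖ |θ.2.2|) := rfl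
  simp only [quadWeight, h1, Pi.add_apply]
  have h3 := sq_abs θ.2.2
  have h4 := sq_abs θ.1
  rcases max_choice |θ.1| (max ‖θ.2.1‖ |θ.2.2|) with h2 | h2 <;> rw [h2]
  · nlinarith [sq_nonneg ‖θ.2.1‖, sq_nonneg θ.2.2]
  · rcases max_choice ‖θ.2.1‖ |θ.2.2| with h2 | h2 <;> rw [h2] <;>
      nlinarith [sq_nonneg ‖θ.2.1‖, sq_nonneg θ.2.2, sq_nonneg θ.1]

theorem integrable_of_abs_le_quadWeight {E : Type*} [NormedAddCommGroup E] [MeasurableSpace E]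
    {F : Type*} [NormedAddCommGroup F]
    {μ : Measure E} (h : Integrable quadWeight μ) {H : E → F} (hH : AEStronglyMeasurable H μ)
    {K : ℝ} (hK : ∀ x, ‖H x‖ ≤ K * quadWeight x) : Integrable H μ :=
  (h.const_mul K).mono' hH (ae_of_all _ hK)

instance : IsProbabilityMeasure (layerInit d) := by unfold layerInit; infer_instance

instance : IsProbabilityMeasure (outInit d) := by unfold outInit; infer_instance

instance : IsGaussian (layerInit d) := by unfold layerInit; infer_instance

instance : IsGaussian (outInit d) := by unfold outInit; infer_instance

theorem integral_inner_mul_layerInit (v : Feat d) (φ : Feat d × ℝ → ℝ) :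
    ∫ θ, ⟪v, θ.1⟫ * φ θ.2 ∂(layerInit d) = 0 := by
  unfold layerInit
  rw [integral_prod_mul (fun u ↦ ⟪v, u⟫) φ]
  have h : ∫ u, ⟪v, u⟫ ∂(stdGaussian (Feat d)) = 0 := integral_strongDual_stdGaussian (innerSL ℝ v)
  rw [h, zero_mul]

theorem integral_fst_mul_outInit (φ : Feat d × ℝ → ℝ) :
    ∫ ω, ω.1 * φ ω.2 ∂(outInit d) = 0 := by
  unfold outInit
  rw [integral_prod_mul (fun a : ℝ ↦ a) φ]
  simp

theorem layerParam_norm_le (θ : LayerParam d) :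
    ‖θ.1‖ ≤ ‖θ‖ ∧ ‖θ.2.1‖ ≤ ‖θ‖ ∧ |θ.2.2| ≤ ‖θ‖ :=
  ⟨norm_fst_le θ, (norm_fst_le θ.2).trans (norm_snd_le θ),
    (norm_snd_le θ.2).trans (norm_snd_le θ)⟩

theorem outParam_norm_le (ω : OutParam d) :
    |ω.1| ≤ ‖ω‖ ∧ ‖ω.2.1‖ ≤ ‖ω‖ ∧ |ω.2.2| ≤ ‖ω‖ :=
  ⟨norm_fst_le ω, (norm_fst_le ω.2).trans (norm_snd_le ω),
    (norm_snd_le ω.2).trans (norm_snd_le ω)⟩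

theorem mul_one_add_add_le {a w b t : ℝ} (hw0 : 0 ≤ w) (hb0 : 0 ≤ b) (ha : a ≤ t)
    (hw : w ≤ t) (hb : b ≤ t) : a * (1 + w + b) ≤ 3 * (1 + t ^ 2) := by
  have ht : 0 ≤ t := hw0.trans hw
  calc a * (1 + w + b) ≤ t * (1 + t + t) := by gcongr
    _ ≤ _ := by nlinarith [sq_nonneg (t - 1)]

variable {L : ℝ} {σ : ℝ → ℝ}

theorem IsActivation.norm_layerMap_le (h : IsActivation L σ) (z : Feat d) (θ : LayerParam d) :
    ‖layerMap σ z θ‖ ≤ 3 * L * (1 + ‖z‖) * quadWeight θ := by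
  obtain ⟨h1, h2, h3⟩ := layerParam_norm_le θ
  have hL := h.nonneg
  unfold layerMap quadWeight
  rw [norm_smul, Real.norm_eq_abs]
  calc |σ (⟪θ.2.1, z⟫ + θ.2.2)| * ‖θ.1‖
      ≤ L * ((1 + ‖z‖) * (1 + ‖θ.2.1‖ + |θ.2.2|)) * ‖θ.1‖ := by
        gcongr; exact h.abs_neuron_le _ _ _
    _ = L * (1 + ‖z‖) * (‖θ.1‖ * (1 + ‖θ.2.1‖ + |θ.2.2|)) := by ring
    _ ≤ L * (1 + ‖z‖) * (3 * (1 + ‖θ‖ ^ 2)) :=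
        mul_le_mul_of_nonneg_left
          (mul_one_add_add_le (norm_nonneg _) (abs_nonneg _) h1 h2 h3) (by positivity)
    _ = _ := by ring

theorem IsActivation.norm_layerMap_sub_le (h : IsActivation L σ) (z z' : Feat d)
    (θ : LayerParam d) :
    ‖layerMap σ z θ - layerMap σ z' θ‖ ≤ L * ‖z - z'‖ * quadWeight θ := by
  obtain ⟨h1, h2, h3⟩ := layerParam_norm_le θ
  have hL := h.nonneg
  unfold layerMap quadWeight
  rw [← sub_smul, norm_smul, Real.norm_eq_abs]
  have h4 : |σ (⟪θ.2.1, z⟫ + θ.2.2) - σ (⟪θ.2.1, z'⟫ + θ.2.2)| ≤ L * (‖θ.2.1‖ * ‖z - z'‖) := by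
    refine (h.abs_sub_le _ _).trans ?_
    gcongr
    rw [add_sub_add_right_eq_sub, ← inner_sub_right]
    exact abs_real_inner_le_norm _ _
  calc _ ≤ L * (‖θ.2.1‖ * ‖z - z'‖) * ‖θ.1‖ := by gcongr
    _ = L * ‖z - z'‖ * (‖θ.2.1‖ * ‖θ.1‖) := by ring
    _ ≤ L * ‖z - z'‖ * (‖θ‖ * ‖θ‖) := by gcongr
    _ ≤ _ := by gcongr; nlinarith

theorem IsActivation.continuous_layerMap (h : IsActivation L σ) (z : Feat d) :
    Continuous (layerMap (d := d) σ z) := by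
  have := h.continuous
  unfold layerMap
  fun_prop

variable {κ Q r : ℝ}

/-- By duality the vector integral `y` is tested against itself. The scalar function `⟪y, u⟫ φ(w,
b)` is centred under the initial law, so the transport inequality bounds `‖y‖²` by a multiple of
`‖y‖ √r`. -/
theorem norm_integral_layer_le (h₀ : HasExpMoment (layerInit d) κ Q) (hr : 0 < r) (hr1 : r ≤ 1)
    {μ : Measure (LayerParam d)} (hμ : LayerP2 μ)
    (hkl : klDiv μ (layerInit d) ≤ ENNReal.ofReal r) {φ : Feat d × ℝ → ℝ} (hφ : Continuous φ)
    {K : ℝ} (hK0 : 0 ≤ K) (hK : ∀ θ : LayerParam d, ‖φ θ.2 • θ.1‖ ≤ K * quadWeight θ) :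
    ‖∫ θ, φ θ.2 • θ.1 ∂μ‖ ≤ (1 / κ + κ * Q) * K * √r := by
  have := hμ.1
  have hint : Integrable (fun θ : LayerParam d ↦ φ θ.2 • θ.1) μ :=
    integrable_of_abs_le_quadWeight hμ.integrable_quadWeight
      (Continuous.aestronglyMeasurable (by fun_prop)) hK
  set y := ∫ θ, φ θ.2 • θ.1 ∂μ with hy
  have hyy : ∫ θ, ⟪y, θ.1⟫ * φ θ.2 ∂μ = ‖y‖ ^ 2 := by
    rw [← real_inner_self_eq_norm_sq]
    nth_rewrite 3 [hy]
    rw [← integral_inner hint]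
    simp only [real_inner_smul_right, mul_comm]
  have hle : ∀ θ : LayerParam d, |⟪y, θ.1⟫ * φ θ.2| ≤ ‖y‖ * K * quadWeight θ := fun θ ↦ by
    rw [mul_comm, ← real_inner_smul_right, mul_assoc]
    exact (abs_real_inner_le_norm _ _).trans (by gcongr; exact hK θ)
  have hcont : Continuous fun θ : LayerParam d ↦ ⟪y, θ.1⟫ * φ θ.2 := by fun_prop
  have h := abs_integral_le_sqrt_of_klDiv_le h₀ hr hr1 hkl hcont.aestronglyMeasurable
    (K := ‖y‖ * K) (by positivity) hle (integral_inner_mul_layerInit y φ)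
    (integrable_of_abs_le_quadWeight hμ.integrable_quadWeight hcont.aestronglyMeasurable hle)
  rw [hyy, abs_of_nonneg (sq_nonneg _)] at h
  rcases (norm_nonneg y).eq_or_lt with h0 | h0
  · rw [← h0]
    have := h₀.pos
    have := h₀.nonneg
    positivity
  · have : ‖y‖ * ‖y‖ ≤ ‖y‖ * ((1 / κ + κ * Q) * K * √r) := by nlinarith
    exact le_of_mul_le_mul_left this h0

variable {α : ℝ} {ν : Kernel ℝ (LayerParam d)} {s : ℝ}

theorem IsActivation.norm_drift_le (h : IsActivation L σ) (h₀ : HasExpMoment (layerInit d) κ Q)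
    (hα : 0 ≤ α) (hr : 0 < r) (hr1 : r ≤ 1) (hν : LayerP2 (ν s))
    (hkl : klDiv (ν s) (layerInit d) ≤ ENNReal.ofReal r) (z : Feat d) :
    ‖drift σ α ν s z‖ ≤ 3 * α * (1 / κ + κ * Q) * L * √r * (1 + ‖z‖) := by
  have hL := h.nonneg
  have hσ := h.continuous
  have := norm_integral_layer_le h₀ hr hr1 hν hkl (φ := fun p ↦ σ (⟪p.1, z⟫ + p.2))
    (by fun_prop) (by positivity) (h.norm_layerMap_le z)
  unfold drift
  rw [norm_smul, Real.norm_of_nonneg hα]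
  calc α * ‖∫ θ, layerMap σ z θ ∂ν s‖
      ≤ α * ((1 / κ + κ * Q) * (3 * L * (1 + ‖z‖)) * √r) := by gcongr; exact this
    _ = _ := by ring

theorem IsActivation.integrable_layerMap (h : IsActivation L σ) {μ : Measure (LayerParam d)}
    (hμ : LayerP2 μ) (z : Feat d) : Integrable (layerMap σ z) μ :=
  integrable_of_abs_le_quadWeight hμ.integrable_quadWeight
    (h.continuous_layerMap z).aestronglyMeasurable (h.norm_layerMap_le z)

theorem IsActivation.norm_drift_sub_le (h : IsActivation L σ)
    (h₀ : HasExpMoment (layerInit d) κ Q)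
    (hα : 0 ≤ α) (hr : 0 < r) (hr1 : r ≤ 1) (hν : LayerP2 (ν s))
    (hkl : klDiv (ν s) (layerInit d) ≤ ENNReal.ofReal r) (z z' : Feat d) :
    ‖drift σ α ν s z - drift σ α ν s z'‖ ≤ α * (1 / κ + κ * Q) * L * √r * ‖z - z'‖ := by
  have hL := h.nonneg
  have hσ := h.continuous
  have := norm_integral_layer_le h₀ hr hr1 hν hkl
    (φ := fun p ↦ σ (⟪p.1, z⟫ + p.2) - σ (⟪p.1, z'⟫ + p.2))
    (K := L * ‖z - z'‖) (by fun_prop) (by positivity)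
    (fun θ ↦ by simpa only [layerMap, sub_smul] using h.norm_layerMap_sub_le z z' θ)
  unfold drift
  rw [← smul_sub, ← integral_sub (h.integrable_layerMap hν z) (h.integrable_layerMap hν z'),
    norm_smul, Real.norm_of_nonneg hα]
  calc α * ‖∫ θ, layerMap σ z θ - layerMap σ z' θ ∂ν s‖
      ≤ α * ((1 / κ + κ * Q) * (L * ‖z - z'‖) * √r) := by
        gcongr; simpa only [layerMap, sub_smul] using this
    _ = _ := by ring

/-- For a relative-entropy radius `r` small enough, trajectories started in the unit ball stay
within distance `O(√r)` of their starting point. -/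
theorem IsActivation.flow_bounds (h : IsActivation L σ) (h₀ : HasExpMoment (layerInit d) κ Q)
    (hα : 0 ≤ α) (hr : 0 < r) (hr1 : r ≤ 1)
    (hsmall : 3 * α * (1 / κ + κ * Q) * L * √r ≤ 1 / 4)
    (hν : ∀ s ∈ Icc (0 : ℝ) 1, LayerP2 (ν s))
    (hkl : ∀ s ∈ Icc (0 : ℝ) 1, klDiv (ν s) (layerInit d) ≤ ENNReal.ofReal r)
    {x : Feat d} (hx : ‖x‖ ≤ 1) {Z : ℝ → Feat d} (hZ : IsFlow σ α ν x Z) :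
    ∀ s ∈ Icc (0 : ℝ) 1, ‖Z s - x‖ ≤ 9 * α * (1 / κ + κ * Q) * L * √r := by
  have hL := h.nonneg
  have hκ := h₀.pos
  have hQ := h₀.nonneg
  set a := 3 * α * (1 / κ + κ * Q) * L * √r with ha
  have ha0 : 0 ≤ a := by positivity
  -- Taking the maximum `M` of `‖Z‖` over the time interval replaces Grönwall: `M ≤ 1 + a (1 + M)`
  -- with `a ≤ 1/4` gives `M ≤ 5/3`.
  obtain ⟨s₀, hs₀, hmax⟩ := isCompact_Icc.exists_isMaxOn (nonempty_Icc.2 zero_le_one)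
    hZ.continuousOn.norm
  have hM : ∀ t ∈ Icc (0 : ℝ) 1, ‖Z t‖ ≤ ‖Z s₀‖ := fun t ht ↦ hmax ht
  have hstep : ∀ s ∈ Icc (0 : ℝ) 1, ‖Z s - x‖ ≤ a * (1 + ‖Z s₀‖) := by
    intro s hs
    rw [hZ.eq s hs, add_sub_cancel_left]
    have hb := intervalIntegral.norm_integral_le_of_norm_le_const (a := 0) (b := s)
      (f := fun t ↦ drift σ α ν t (Z t)) (C := a * (1 + ‖Z s₀‖)) (fun t ht ↦ by
        rw [uIoc_of_le hs.1] at ht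
        have ht' : t ∈ Icc (0 : ℝ) 1 := ⟨ht.1.le, ht.2.trans hs.2⟩
        refine (h.norm_drift_le h₀ hα hr hr1 (hν t ht') (hkl t ht') (Z t)).trans ?_
        gcongr
        exact hM t ht')
    refine hb.trans ?_
    rw [sub_zero, abs_of_nonneg hs.1]
    exact mul_le_of_le_one_right (by positivity) hs.2
  have h2 : ‖Z s₀‖ ≤ 2 := by
    have h3 := hstep s₀ hs₀
    have h4 : ‖Z s₀‖ ≤ ‖Z s₀ - x‖ + ‖x‖ := by simpa using norm_add_le (Z s₀ - x) x
    nlinarith [norm_nonneg (Z s₀)]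
  intro s hs
  calc ‖Z s - x‖ ≤ a * (1 + ‖Z s₀‖) := hstep s hs
    _ ≤ a * (1 + 2) := by gcongr
    _ = _ := by rw [ha]; ring

end Params

/-! ### Effect of the flow on signed averages, uniformly in the layer laws. -/

section Displacement

variable {d n : ℕ}

theorem signAvg_integral {E : Type*} [MeasurableSpace E] {μ : Measure E} (η : Fin n → ℤˣ)
    {F : Fin n → E → ℝ} (hF : ∀ i, Integrable (F i) μ) :
    signAvg η (fun i ↦ ∫ t, F i t ∂μ) = ∫ t, signAvg η (fun i ↦ F i t) ∂μ := by
  simp only [signAvg]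
  rw [integral_const_mul, integral_finsetSum _ fun i _ ↦ (hF i).const_mul _]
  simp only [integral_const_mul]

/-- The signed average of `σ'(⟨w, xᵢ⟩ + b) σ(⟨w', xᵢ⟩ + b')`, with `θ = (u, w', b')`. -/
def tangentAvg (σ : ℝ → ℝ) (x : Fin n → Feat d) (η : Fin n → ℤˣ) (p q : Feat d × ℝ) : ℝ :=
  signAvg η fun i ↦ deriv σ (⟪p.1, x i⟫ + p.2) * σ (⟪q.1, x i⟫ + q.2)

/-- The weighted second moment of `⟨w, u⟩ · tangentAvg` under the initial layer distribution. -/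
def tangentVar (κ : ℝ) (σ : ℝ → ℝ) (x : Fin n → Feat d) (η : Fin n → ℤˣ) (p : Feat d × ℝ) : ℝ :=
  ∫ θ, (⟪p.1, θ.1⟫ * tangentAvg σ x η p θ.2) ^ 2 * expWeight κ θ ∂(layerInit d)

variable {L : ℝ} {σ : ℝ → ℝ} {x : Fin n → Feat d} {κ Q r α : ℝ}

theorem IsActivation.continuous_tangent (h : IsActivation L σ) (x : Fin n → Feat d)
    (η : Fin n → ℤˣ) :
    Continuous fun z : (Feat d × ℝ) × LayerParam d ↦
      ⟪z.1.1, z.2.1⟫ * tangentAvg σ x η z.1 z.2.2 := by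
  have := h.continuous
  have := h.continuous_deriv
  unfold tangentAvg signAvg
  fun_prop

theorem IsActivation.continuous_tangent_right (h : IsActivation L σ) (x : Fin n → Feat d)
    (η : Fin n → ℤˣ) (p : Feat d × ℝ) :
    Continuous fun θ : LayerParam d ↦ ⟪p.1, θ.1⟫ * tangentAvg σ x η p θ.2 :=
  (h.continuous_tangent x η).comp (Continuous.prodMk_right p)

theorem IsActivation.abs_tangent_coord_le (h : IsActivation L σ) (hx : ∀ i, ‖x i‖ ≤ 1)
    (p q : Feat d × ℝ) (i : Fin n) :
    |deriv σ (⟪p.1, x i⟫ + p.2) * σ (⟪q.1, x i⟫ + q.2)| ≤ L ^ 2 * (1 + ‖q.1‖ + |q.2|) := by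
  have hL := h.nonneg
  rw [abs_mul, sq, mul_assoc]
  gcongr
  · exact h.deriv_le _
  · exact h.abs_neuron_le_of_norm_le_one _ (hx i) _

theorem abs_inner_mul_le (w : Feat d) (θ : LayerParam d) {M t : ℝ} (hM : 0 ≤ M)
    (ht : |t| ≤ M * (1 + ‖θ.2.1‖ + |θ.2.2|)) :
    |⟪w, θ.1⟫ * t| ≤ 3 * M * ‖w‖ * quadWeight θ := by
  obtain ⟨h1, h2, h3⟩ := layerParam_norm_le θ
  rw [abs_mul]
  calc |⟪w, θ.1⟫| * |t| ≤ ‖w‖ * ‖θ.1‖ * (M * (1 + ‖θ.2.1‖ + |θ.2.2|)) := by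
        gcongr; exact abs_real_inner_le_norm _ _
    _ = M * ‖w‖ * (‖θ.1‖ * (1 + ‖θ.2.1‖ + |θ.2.2|)) := by ring
    _ ≤ M * ‖w‖ * (3 * (1 + ‖θ‖ ^ 2)) :=
        mul_le_mul_of_nonneg_left
          (mul_one_add_add_le (norm_nonneg _) (abs_nonneg _) h1 h2 h3) (by positivity)
    _ = _ := by unfold quadWeight; ring

theorem IsActivation.abs_tangent_le (h : IsActivation L σ) (hn : 0 < n) (hx : ∀ i, ‖x i‖ ≤ 1)
    (η : Fin n → ℤˣ) (p : Feat d × ℝ) (θ : LayerParam d) :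
    |⟪p.1, θ.1⟫ * tangentAvg σ x η p θ.2| ≤ 3 * L ^ 2 * ‖p.1‖ * quadWeight θ :=
  abs_inner_mul_le _ _ (sq_nonneg L) (abs_signAvg_le hn η (h.abs_tangent_coord_le hx p θ.2))

theorem tangentVar_nonneg (κ : ℝ) (σ : ℝ → ℝ) (x : Fin n → Feat d) (η : Fin n → ℤˣ)
    (p : Feat d × ℝ) : 0 ≤ tangentVar κ σ x η p :=
  integral_nonneg fun θ ↦ mul_nonneg (sq_nonneg _) (expWeight_pos κ θ).le

theorem IsActivation.tangentVar_le (h : IsActivation L σ) (h₀ : HasExpMoment (layerInit d) κ Q)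
    (hn : 0 < n) (hx : ∀ i, ‖x i‖ ≤ 1) (η : Fin n → ℤˣ) (p : Feat d × ℝ) :
    tangentVar κ σ x η p ≤ 9 * L ^ 4 * Q * ‖p.1‖ ^ 2 :=
  (integral_sq_mul_expWeight_le h₀ (h.abs_tangent_le hn hx η p)).trans (le_of_eq (by ring))

theorem IsActivation.stronglyMeasurable_tangentVar (h : IsActivation L σ) (κ : ℝ)
    (x : Fin n → Feat d) (η : Fin n → ℤˣ) : StronglyMeasurable (tangentVar κ σ x η) := by
  have hc : Continuous fun z : (Feat d × ℝ) × LayerParam d ↦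
      (⟪z.1.1, z.2.1⟫ * tangentAvg σ x η z.1 z.2.2) ^ 2 * expWeight κ z.2 :=
    ((h.continuous_tangent x η).pow 2).mul ((continuous_expWeight κ).comp continuous_snd)
  exact hc.stronglyMeasurable.integral_prod_right

/-- For each fixed `θ` the signed average has second moment `O(1/n)` by orthogonality of the signs,
and this survives integration over the initial law, which does not depend on the signs. -/
theorem IsActivation.signMean_tangentVar_le (h : IsActivation L σ)
    (h₀ : HasExpMoment (layerInit d) κ Q) (hn : 0 < n) (hx : ∀ i, ‖x i‖ ≤ 1) (p : Feat d × ℝ) :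
    signMean (fun η ↦ tangentVar κ σ x η p) ≤ 9 * L ^ 4 * Q * ‖p.1‖ ^ 2 / n := by
  have hn' : (0 : ℝ) < n := by exact_mod_cast hn
  unfold tangentVar
  have hle : ∀ η (θ : LayerParam d), (⟪p.1, θ.1⟫ * tangentAvg σ x η p θ.2) ^ 2 ≤
      (3 * L ^ 2 * ‖p.1‖) ^ 2 * quadWeight θ ^ 2 := fun η θ ↦ by
    rw [← mul_pow, ← sq_abs]
    exact pow_le_pow_left₀ (abs_nonneg _) (h.abs_tangent_le hn hx η p θ) 2
  rw [signMean_integral]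
  · refine (h₀.integral_le_of_le (C := 9 * L ^ 4 * ‖p.1‖ ^ 2 / n) (fun θ ↦ ?_) (by positivity)
      fun θ ↦ ?_).trans (le_of_eq (by ring))
    · rw [← signMean_const (n := n) 0]
      exact signMean_mono fun η ↦ mul_nonneg (sq_nonneg _) (expWeight_pos κ θ).le
    · have h1 : (fun η ↦ (⟪p.1, θ.1⟫ * tangentAvg σ x η p θ.2) ^ 2 * expWeight κ θ) = fun η ↦
          (⟪p.1, θ.1⟫ ^ 2 * expWeight κ θ) * tangentAvg σ x η p θ.2 ^ 2 := by funext η; ring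
      rw [h1, signMean_const_mul]
      have h2 : signMean (fun η ↦ tangentAvg σ x η p θ.2 ^ 2) ≤
          (L ^ 2 * (1 + ‖θ.2.1‖ + |θ.2.2|)) ^ 2 / n :=
        signMean_signAvg_sq_le hn (h.abs_tangent_coord_le hx p θ.2)
      have he := expWeight_pos κ θ
      have h3 : |⟪p.1, θ.1⟫ * (L ^ 2 * (1 + ‖θ.2.1‖ + |θ.2.2|))| ≤
          3 * L ^ 2 * ‖p.1‖ * quadWeight θ :=
        abs_inner_mul_le _ _ (sq_nonneg L) (le_of_eq (abs_of_nonneg (by positivity)))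
      have h4 : (⟪p.1, θ.1⟫ * (L ^ 2 * (1 + ‖θ.2.1‖ + |θ.2.2|))) ^ 2 ≤
          9 * L ^ 4 * ‖p.1‖ ^ 2 * quadWeight θ ^ 3 := by
        rw [← sq_abs]
        calc _ ≤ (3 * L ^ 2 * ‖p.1‖ * quadWeight θ) ^ 2 := pow_le_pow_left₀ (abs_nonneg _) h3 2
          _ = 9 * L ^ 4 * ‖p.1‖ ^ 2 * quadWeight θ ^ 2 := by ring
          _ ≤ _ := by gcongr ?_ * ?_; exact pow_le_quadWeight_cube θ (by norm_num)
      calc ⟪p.1, θ.1⟫ ^ 2 * expWeight κ θ * signMean (fun η ↦ tangentAvg σ x η p θ.2 ^ 2)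
          ≤ ⟪p.1, θ.1⟫ ^ 2 * expWeight κ θ * ((L ^ 2 * (1 + ‖θ.2.1‖ + |θ.2.2|)) ^ 2 / n) := by
            gcongr
        _ = (⟪p.1, θ.1⟫ * (L ^ 2 * (1 + ‖θ.2.1‖ + |θ.2.2|))) ^ 2 * (expWeight κ θ / n) := by ring
        _ ≤ 9 * L ^ 4 * ‖p.1‖ ^ 2 * quadWeight θ ^ 3 * (expWeight κ θ / n) := by gcongr
        _ = _ := by ring
  · intro η
    have hc := h.continuous_tangent_right x η p
    refine h₀.integrable_of_le (((hc.pow 2).mul (continuous_expWeight κ)).aestronglyMeasurable)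
      ((3 * L ^ 2 * ‖p.1‖) ^ 2) fun θ ↦ ?_
    have he := expWeight_pos κ θ
    rw [abs_of_nonneg (by positivity)]
    calc _ ≤ (3 * L ^ 2 * ‖p.1‖) ^ 2 * quadWeight θ ^ 2 * expWeight κ θ :=
          mul_le_mul_of_nonneg_right (hle η θ) he.le
      _ ≤ (3 * L ^ 2 * ‖p.1‖) ^ 2 * quadWeight θ ^ 3 * expWeight κ θ := by
          gcongr ?_ * ?_ * ?_; exact pow_le_quadWeight_cube θ (by norm_num)
      _ = _ := by ring

variable {ν : Kernel ℝ (LayerParam d)}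

/-- The signed average of the drifts at the data points, tested against `σ'(⟨w, xᵢ⟩ + b) w`. -/
theorem IsActivation.abs_signAvg_drift_le (h : IsActivation L σ) (hL1 : 1 ≤ L)
    (h₀ : HasExpMoment (layerInit d) κ Q) (hn : 0 < n) (hx : ∀ i, ‖x i‖ ≤ 1) (hα : 0 ≤ α)
    (hr : 0 < r) {s : ℝ} (hν : LayerP2 (ν s))
    (hkl : klDiv (ν s) (layerInit d) ≤ ENNReal.ofReal r) (η : Fin n → ℤˣ) (p : Feat d × ℝ) :
    |signAvg η (fun i ↦ deriv σ (⟪p.1, x i⟫ + p.2) * ⟪p.1, drift σ α ν s (x i)⟫)| ≤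
      α * (3 * L ^ 2 / κ * (1 + ‖p.1‖) * r + κ * tangentVar κ σ x η p) := by
  have := hν.1
  have hκ := h₀.pos
  have hint : ∀ i, Integrable (fun θ : LayerParam d ↦
      deriv σ (⟪p.1, x i⟫ + p.2) * ⟪p.1, layerMap σ (x i) θ⟫) (ν s) := fun i ↦
    ((h.integrable_layerMap hν (x i)).const_inner p.1).const_mul _
  have heq : signAvg η (fun i ↦ deriv σ (⟪p.1, x i⟫ + p.2) * ⟪p.1, drift σ α ν s (x i)⟫) =
      α * ∫ θ, ⟪p.1, θ.1⟫ * tangentAvg σ x η p θ.2 ∂(ν s) := by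
    have h1 : ∀ i, deriv σ (⟪p.1, x i⟫ + p.2) * ⟪p.1, drift σ α ν s (x i)⟫ =
        α * ∫ θ, deriv σ (⟪p.1, x i⟫ + p.2) * ⟪p.1, layerMap σ (x i) θ⟫ ∂(ν s) := fun i ↦ by
      rw [integral_const_mul, integral_inner (h.integrable_layerMap hν (x i)), drift,
        real_inner_smul_right]
      ring
    simp only [h1]
    rw [signAvg_const_mul, signAvg_integral η hint]
    congr 2
    funext θ
    rw [tangentAvg, ← signAvg_const_mul]
    congr 1
    funext i
    rw [layerMap, real_inner_smul_right]
    ring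
  rw [heq, abs_mul, abs_of_nonneg hα]
  refine mul_le_mul_of_nonneg_left ?_ hα
  have hc := h.continuous_tangent_right x η p
  have hK : ∀ θ : LayerParam d, |⟪p.1, θ.1⟫ * tangentAvg σ x η p θ.2| ≤
      3 * L ^ 2 * (1 + ‖p.1‖) * quadWeight θ := fun θ ↦ by
    refine (h.abs_tangent_le hn hx η p θ).trans ?_
    have := (quadWeight_pos θ).le
    gcongr
    linarith
  have hp := norm_nonneg p.1
  -- Here `λ` does not depend on `r`: the entropy then costs `O(r)` rather than `O(√r)`, and the
  -- variance term is already small in mean. Using `1 + ‖p.1‖` avoids dividing by zero.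
  have hmain := abs_integral_le_of_klDiv_le h₀ hr.le hkl hc.aestronglyMeasurable hK
    (integral_inner_mul_layerInit p.1 (tangentAvg σ x η p))
    (integrable_of_abs_le_quadWeight hν.integrable_quadWeight hc.aestronglyMeasurable hK)
    (lam := κ / (3 * L ^ 2 * (1 + ‖p.1‖))) (by positivity)
    (by rw [div_mul_cancel₀]; positivity)
  refine hmain.trans (add_le_add (le_of_eq (by field_simp)) ?_)
  refine mul_le_mul_of_nonneg_right (div_le_self hκ.le ?_) (tangentVar_nonneg κ σ x η p)
  nlinarith [mul_nonneg (sq_nonneg L) hp]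

/-- Effect of the residual flow on the signed average of a neuron. -/
theorem IsActivation.abs_signAvg_flow_sub_le (h : IsActivation L σ) (hL1 : 1 ≤ L)
    (h₀ : HasExpMoment (layerInit d) κ Q) (hn : 0 < n) (hx : ∀ i, ‖x i‖ ≤ 1) (hα : 0 ≤ α)
    (hr : 0 < r) (hr1 : r ≤ 1) (hsmall : 3 * α * (1 / κ + κ * Q) * L * √r ≤ 1 / 4)
    (hν : ∀ s ∈ Icc (0 : ℝ) 1, LayerP2 (ν s))
    (hkl : ∀ s ∈ Icc (0 : ℝ) 1, klDiv (ν s) (layerInit d) ≤ ENNReal.ofReal r)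
    {Z : Fin n → ℝ → Feat d} (hZ : ∀ i, IsFlow σ α ν (x i) (Z i))
    (η : Fin n → ℤˣ) (p : Feat d × ℝ) :
    |signAvg η (fun i ↦ σ (⟪p.1, Z i 1⟫ + p.2) - σ (⟪p.1, x i⟫ + p.2))| ≤
      (α * (3 * L ^ 2 / κ) + 9 * L * (α * (1 / κ + κ * Q) * L) ^ 2 * (1 + 9 * L)) *
        (1 + ‖p.1‖) ^ 2 * r + α * κ * tangentVar κ σ x η p := by
  have hκ := h₀.pos
  have hQ := h₀.nonneg
  have hL := h.nonneg
  have hp := norm_nonneg p.1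
  have hss : √r * √r = r := Real.mul_self_sqrt hr.le
  set a := α * (1 / κ + κ * Q) * L with ha
  have ha0 : 0 ≤ a := by positivity
  have hdisp : ∀ i, ∀ s ∈ Icc (0 : ℝ) 1, ‖Z i s - x i‖ ≤ 9 * a * √r := fun i s hs ↦
    (h.flow_bounds h₀ hα hr hr1 hsmall hν hkl (hx i) (hZ i) s hs).trans
      (le_of_eq (by rw [ha]; ring))
  set c : Fin n → ℝ := fun i ↦ deriv σ (⟪p.1, x i⟫ + p.2) with hc
  have hcL : ∀ i, |c i| ≤ L := fun i ↦ h.deriv_le _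
  -- First-order Taylor expansion in the displacement; the remainder is quadratic in a quantity of
  -- size `√r`, hence `O(r)`.
  have hsplit : signAvg η (fun i ↦ σ (⟪p.1, Z i 1⟫ + p.2) - σ (⟪p.1, x i⟫ + p.2)) =
      signAvg η (fun i ↦ σ (⟪p.1, Z i 1⟫ + p.2) - σ (⟪p.1, x i⟫ + p.2) -
        c i * ⟪p.1, Z i 1 - x i⟫) + signAvg η (fun i ↦ c i * ⟪p.1, Z i 1 - x i⟫) := by
    rw [← signAvg_add]; congr 1; funext i; ring
  have hrem : |signAvg η (fun i ↦ σ (⟪p.1, Z i 1⟫ + p.2) - σ (⟪p.1, x i⟫ + p.2) -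
      c i * ⟪p.1, Z i 1 - x i⟫)| ≤ 81 * L * a ^ 2 * ‖p.1‖ ^ 2 * r := by
    refine abs_signAvg_le hn η fun i ↦ ?_
    have h1 := h.abs_taylor_le (⟪p.1, x i⟫ + p.2) ⟪p.1, Z i 1 - x i⟫
    have h2 : ⟪p.1, x i⟫ + p.2 + ⟪p.1, Z i 1 - x i⟫ = ⟪p.1, Z i 1⟫ + p.2 := by
      rw [inner_sub_right]; ring
    rw [h2] at h1
    refine h1.trans ?_
    have h3 : |⟪p.1, Z i 1 - x i⟫| ≤ ‖p.1‖ * (9 * a * √r) :=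
      (abs_real_inner_le_norm _ _).trans
        (by gcongr; exact hdisp i 1 (right_mem_Icc.2 zero_le_one))
    calc L * ⟪p.1, Z i 1 - x i⟫ ^ 2 ≤ L * (‖p.1‖ * (9 * a * √r)) ^ 2 := by
          rw [← sq_abs ⟪p.1, Z i 1 - x i⟫]; gcongr
      _ = 81 * L * a ^ 2 * ‖p.1‖ ^ 2 * (√r * √r) := by ring
      _ = _ := by rw [hss]
  -- Freezing the drift at `x i` costs its Lipschitz constant `O(√r)` times the displacement
  -- `O(√r)`, again `O(r)`. The frozen part is the signed drift average bounded above.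
  have hlin : |signAvg η (fun i ↦ c i * ⟪p.1, Z i 1 - x i⟫)| ≤
      α * (3 * L ^ 2 / κ * (1 + ‖p.1‖) * r + κ * tangentVar κ σ x η p) +
        9 * L * a ^ 2 * ‖p.1‖ * r := by
    have hI : ∀ i, IntervalIntegrable (fun t ↦ drift σ α ν t (Z i t)) volume 0 1 :=
      fun i ↦ (hZ i).integrable
    have heq : signAvg η (fun i ↦ c i * ⟪p.1, Z i 1 - x i⟫) =
        ∫ t in (0 : ℝ)..1, signAvg η (fun i ↦ c i * ⟪p.1, drift σ α ν t (Z i t)⟫) := by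
      have hI' : ∀ i, Integrable (fun t ↦ drift σ α ν t (Z i t)) (volume.restrict (Ioc 0 1)) :=
        fun i ↦ (intervalIntegrable_iff_integrableOn_Ioc_of_le zero_le_one).1 (hI i)
      rw [intervalIntegral.integral_of_le zero_le_one,
        ← signAvg_integral η fun i ↦ ((hI' i).const_inner p.1).const_mul (c i)]
      congr 1
      funext i
      rw [integral_const_mul, integral_inner (hI' i),
        ← intervalIntegral.integral_of_le zero_le_one,
        (hZ i).eq 1 (right_mem_Icc.2 zero_le_one), add_sub_cancel_left]
    rw [heq]
    have hb := intervalIntegral.norm_integral_le_of_norm_le_const (a := 0) (b := 1)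
      (f := fun t ↦ signAvg η (fun i ↦ c i * ⟪p.1, drift σ α ν t (Z i t)⟫))
      (C := α * (3 * L ^ 2 / κ * (1 + ‖p.1‖) * r + κ * tangentVar κ σ x η p) +
        9 * L * a ^ 2 * ‖p.1‖ * r) (fun t ht ↦ by
        rw [uIoc_of_le zero_le_one] at ht
        have ht' : t ∈ Icc (0 : ℝ) 1 := ⟨ht.1.le, ht.2⟩
        have h1 : signAvg η (fun i ↦ c i * ⟪p.1, drift σ α ν t (Z i t)⟫) =
            signAvg η (fun i ↦ c i * ⟪p.1, drift σ α ν t (x i)⟫) + signAvg η (fun i ↦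
              c i * ⟪p.1, drift σ α ν t (Z i t) - drift σ α ν t (x i)⟫) := by
          rw [← signAvg_add]; congr 1; funext i; rw [inner_sub_right]; ring
        rw [h1]
        refine (norm_add_le _ _).trans (add_le_add
          (h.abs_signAvg_drift_le hL1 h₀ hn hx hα hr (hν t ht') (hkl t ht') η p) ?_)
        refine abs_signAvg_le hn η fun i ↦ ?_
        have h2 : ‖drift σ α ν t (Z i t) - drift σ α ν t (x i)‖ ≤ 9 * a ^ 2 * r := by
          calc _ ≤ a * √r * ‖Z i t - x i‖ :=
                h.norm_drift_sub_le h₀ hα hr hr1 (hν t ht') (hkl t ht') _ _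
            _ ≤ a * √r * (9 * a * √r) := by gcongr; exact hdisp i t ht'
            _ = 9 * a ^ 2 * (√r * √r) := by ring
            _ = _ := by rw [hss]
        rw [abs_mul]
        calc |c i| * |⟪p.1, drift σ α ν t (Z i t) - drift σ α ν t (x i)⟫|
            ≤ L * (‖p.1‖ * (9 * a ^ 2 * r)) := by
              gcongr
              · exact hcL i
              · exact (abs_real_inner_le_norm _ _).trans (by gcongr)
          _ = _ := by ring)
    simpa using hb
  rw [hsplit]
  refine (abs_add_le _ _).trans ((add_le_add hrem hlin).trans ?_)
  have h1 : 1 + ‖p.1‖ ≤ (1 + ‖p.1‖) ^ 2 := by nlinarith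
  have h2 : ‖p.1‖ ≤ (1 + ‖p.1‖) ^ 2 := by nlinarith
  have h3 : ‖p.1‖ ^ 2 ≤ (1 + ‖p.1‖) ^ 2 := by nlinarith
  calc _ = α * (3 * L ^ 2 / κ) * (1 + ‖p.1‖) * r + 9 * L * a ^ 2 * ‖p.1‖ * r +
        81 * L * a ^ 2 * ‖p.1‖ ^ 2 * r + α * κ * tangentVar κ σ x η p := by ring
    _ ≤ α * (3 * L ^ 2 / κ) * (1 + ‖p.1‖) ^ 2 * r + 9 * L * a ^ 2 * (1 + ‖p.1‖) ^ 2 * r +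
        81 * L ^ 2 * a ^ 2 * (1 + ‖p.1‖) ^ 2 * r + α * κ * tangentVar κ σ x η p := by
      gcongr
      nlinarith
    _ = _ := by ring

/-- Crude form of the effect of the residual flow on a signed average. -/
theorem IsActivation.abs_signAvg_flow_sub_le_sqrt (h : IsActivation L σ)
    (h₀ : HasExpMoment (layerInit d) κ Q) (hn : 0 < n) (hx : ∀ i, ‖x i‖ ≤ 1) (hα : 0 ≤ α)
    (hr : 0 < r) (hr1 : r ≤ 1) (hsmall : 3 * α * (1 / κ + κ * Q) * L * √r ≤ 1 / 4)
    (hν : ∀ s ∈ Icc (0 : ℝ) 1, LayerP2 (ν s))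
    (hkl : ∀ s ∈ Icc (0 : ℝ) 1, klDiv (ν s) (layerInit d) ≤ ENNReal.ofReal r)
    {Z : Fin n → ℝ → Feat d} (hZ : ∀ i, IsFlow σ α ν (x i) (Z i))
    (η : Fin n → ℤˣ) (p : Feat d × ℝ) :
    |signAvg η (fun i ↦ σ (⟪p.1, Z i 1⟫ + p.2) - σ (⟪p.1, x i⟫ + p.2))| ≤
      9 * α * (1 / κ + κ * Q) * L ^ 2 * √r * ‖p.1‖ := by
  have hL := h.nonneg
  refine abs_signAvg_le hn η fun i ↦ (h.abs_sub_le _ _).trans ?_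
  rw [add_sub_add_right_eq_sub, ← inner_sub_right]
  calc L * |⟪p.1, Z i 1 - x i⟫| ≤ L * (‖p.1‖ * ‖Z i 1 - x i‖) := by
        gcongr; exact abs_real_inner_le_norm _ _
    _ ≤ L * (‖p.1‖ * (9 * α * (1 / κ + κ * Q) * L * √r)) := by
        gcongr
        exact h.flow_bounds h₀ hα hr hr1 hsmall hν hkl (hx i) (hZ i) 1
          (right_mem_Icc.2 zero_le_one)
    _ = _ := by ring

end Displacement

/-! ### The output layer: energy estimates and the bound for fixed signs. -/

section Output

variable {d n : ℕ} {L : ℝ} {σ : ℝ → ℝ} {x : Fin n → Feat d} {κ Q κ' Q' r α c₃ c₄ : ℝ}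

/-- Pointwise bound for the square of the signed average of the outputs. -/
def outEnergy (κ c₃ c₄ r : ℝ) (σ : ℝ → ℝ) (x : Fin n → Feat d) (η : Fin n → ℤˣ)
    (ω : OutParam d) : ℝ :=
  2 * (ω.1 * signAvg η (fun i ↦ σ (⟪ω.2.1, x i⟫ + ω.2.2))) ^ 2 +
    4 * c₃ ^ 2 * r ^ 2 * (ω.1 * (1 + ‖ω.2.1‖) ^ 2) ^ 2 +
    4 * c₄ ^ 2 * (ω.1 * tangentVar κ σ x η ω.2) ^ 2

theorem outEnergy_nonneg (κ c₃ c₄ r : ℝ) (σ : ℝ → ℝ) (x : Fin n → Feat d) (η : Fin n → ℤˣ)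
    (ω : OutParam d) : 0 ≤ outEnergy κ c₃ c₄ r σ x η ω := by
  unfold outEnergy; positivity

theorem abs_out_mul_le {M t : ℝ} (hM : 0 ≤ M) (ω : OutParam d)
    (ht : |t| ≤ M * (1 + ‖ω.2.1‖ + |ω.2.2|)) : |ω.1 * t| ≤ 3 * M * quadWeight ω := by
  obtain ⟨h1, h2, h3⟩ := outParam_norm_le ω
  rw [abs_mul]
  calc |ω.1| * |t| ≤ |ω.1| * (M * (1 + ‖ω.2.1‖ + |ω.2.2|)) := by gcongr
    _ = M * (|ω.1| * (1 + ‖ω.2.1‖ + |ω.2.2|)) := by ring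
    _ ≤ M * (3 * (1 + ‖ω‖ ^ 2)) :=
        mul_le_mul_of_nonneg_left (mul_one_add_add_le (norm_nonneg _) (abs_nonneg _) h1 h2 h3) hM
    _ = _ := by unfold quadWeight; ring

theorem out_mul_one_add_sq_le (ω : OutParam d) :
    (ω.1 * (1 + ‖ω.2.1‖) ^ 2) ^ 2 ≤ 4 * quadWeight ω ^ 3 := by
  obtain ⟨h1, h2, -⟩ := outParam_norm_le ω
  have h3 : ω.1 ^ 2 ≤ quadWeight ω := by
    rw [← sq_abs]; unfold quadWeight; nlinarith [abs_nonneg ω.1]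
  have h4 : (1 + ‖ω.2.1‖) ^ 2 ≤ 2 * quadWeight ω := by
    unfold quadWeight; nlinarith [norm_nonneg ω.2.1, sq_nonneg (1 - ‖ω.2.1‖)]
  have hq := (quadWeight_pos ω).le
  calc (ω.1 * (1 + ‖ω.2.1‖) ^ 2) ^ 2 = ω.1 ^ 2 * ((1 + ‖ω.2.1‖) ^ 2) ^ 2 := by ring
    _ ≤ quadWeight ω * (2 * quadWeight ω) ^ 2 := by gcongr
    _ = _ := by ring

theorem out_mul_sq_le (ω : OutParam d) :
    (ω.1 * ‖ω.2.1‖ ^ 2) ^ 2 ≤ quadWeight ω ^ 3 := by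
  obtain ⟨h1, h2, -⟩ := outParam_norm_le ω
  have h3 : ω.1 ^ 2 ≤ quadWeight ω := by
    rw [← sq_abs]; unfold quadWeight; nlinarith [abs_nonneg ω.1]
  have h4 : ‖ω.2.1‖ ^ 2 ≤ quadWeight ω := by
    unfold quadWeight; nlinarith [norm_nonneg ω.2.1]
  have hq := (quadWeight_pos ω).le
  calc (ω.1 * ‖ω.2.1‖ ^ 2) ^ 2 = ω.1 ^ 2 * (‖ω.2.1‖ ^ 2) ^ 2 := by ring
    _ ≤ quadWeight ω * quadWeight ω ^ 2 := by gcongr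
    _ = _ := by ring

/-- The constant in the bound for `outEnergy`. -/
def energyConst (L Q c₃ c₄ : ℝ) : ℝ := 18 * L ^ 2 + 16 * c₃ ^ 2 + 324 * c₄ ^ 2 * L ^ 8 * Q ^ 2

theorem energyConst_nonneg (L Q c₃ c₄ : ℝ) : 0 ≤ energyConst L Q c₃ c₄ := by
  unfold energyConst
  have : 0 ≤ L ^ 8 := by positivity
  positivity

theorem IsActivation.outEnergy_le (h : IsActivation L σ)
    (h₀ : HasExpMoment (layerInit d) κ Q) (hn : 0 < n) (hx : ∀ i, ‖x i‖ ≤ 1)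
    (hr : 0 < r) (hr1 : r ≤ 1) (η : Fin n → ℤˣ) (ω : OutParam d) :
    outEnergy κ c₃ c₄ r σ x η ω ≤ energyConst L Q c₃ c₄ * quadWeight ω ^ 3 := by
  have hL := h.nonneg
  have hQ := h₀.nonneg
  have hq3 := pow_le_quadWeight_cube ω (k := 2) (by norm_num)
  have h1 : (ω.1 * signAvg η (fun i ↦ σ (⟪ω.2.1, x i⟫ + ω.2.2))) ^ 2 ≤
      9 * L ^ 2 * quadWeight ω ^ 3 := by
    have h2 := abs_out_mul_le hL ω (abs_signAvg_le hn η (a := fun i ↦ σ (⟪ω.2.1, x i⟫ + ω.2.2))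
      fun i ↦ h.abs_neuron_le_of_norm_le_one _ (hx i) _)
    rw [← sq_abs]
    calc _ ≤ (3 * L * quadWeight ω) ^ 2 := pow_le_pow_left₀ (abs_nonneg _) h2 2
      _ = 9 * L ^ 2 * quadWeight ω ^ 2 := by ring
      _ ≤ _ := by gcongr
  have h3 : (ω.1 * tangentVar κ σ x η ω.2) ^ 2 ≤ 81 * L ^ 8 * Q ^ 2 * quadWeight ω ^ 3 := by
    have h4 := h.tangentVar_le h₀ hn hx η ω.2
    have h5 := tangentVar_nonneg κ σ x η ω.2
    calc (ω.1 * tangentVar κ σ x η ω.2) ^ 2 = ω.1 ^ 2 * tangentVar κ σ x η ω.2 ^ 2 := by ring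
      _ ≤ ω.1 ^ 2 * (9 * L ^ 4 * Q * ‖ω.2.1‖ ^ 2) ^ 2 := by gcongr
      _ = 81 * L ^ 8 * Q ^ 2 * (ω.1 * ‖ω.2.1‖ ^ 2) ^ 2 := by ring
      _ ≤ _ := by gcongr; exact out_mul_sq_le ω
  have h6 : r ^ 2 ≤ 1 := pow_le_one₀ hr.le hr1
  unfold outEnergy energyConst
  calc _ ≤ 2 * (9 * L ^ 2 * quadWeight ω ^ 3) + 4 * c₃ ^ 2 * 1 * (4 * quadWeight ω ^ 3) +
        4 * c₄ ^ 2 * (81 * L ^ 8 * Q ^ 2 * quadWeight ω ^ 3) := by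
        gcongr; exact out_mul_one_add_sq_le ω
    _ = _ := by ring

theorem IsActivation.signMean_outEnergy_le (h : IsActivation L σ)
    (h₀ : HasExpMoment (layerInit d) κ Q) (hn : 0 < n) (hx : ∀ i, ‖x i‖ ≤ 1)
    (hrn : r ^ 2 * n ≤ 1) (ω : OutParam d) :
    signMean (fun η ↦ outEnergy κ c₃ c₄ r σ x η ω) ≤
      energyConst L Q c₃ c₄ / n * quadWeight ω ^ 3 := by
  have hn' : (0 : ℝ) < n := by exact_mod_cast hn
  have hL := h.nonneg
  have hQ := h₀.nonneg
  have hq3 := pow_le_quadWeight_cube ω (k := 2) (by norm_num)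
  have h1 : signMean (fun η ↦ (ω.1 * signAvg η (fun i ↦ σ (⟪ω.2.1, x i⟫ + ω.2.2))) ^ 2) ≤
      9 * L ^ 2 / n * quadWeight ω ^ 3 := by
    simp only [mul_pow]
    rw [signMean_const_mul]
    have h2 := signMean_signAvg_sq_le hn (a := fun i ↦ σ (⟪ω.2.1, x i⟫ + ω.2.2))
      fun i ↦ h.abs_neuron_le_of_norm_le_one ω.2.1 (hx i) ω.2.2
    have h3 := abs_out_mul_le hL ω (t := L * (1 + ‖ω.2.1‖ + |ω.2.2|))
      (le_of_eq (abs_of_nonneg (by positivity)))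
    have h4 : (ω.1 * (L * (1 + ‖ω.2.1‖ + |ω.2.2|))) ^ 2 ≤ 9 * L ^ 2 * quadWeight ω ^ 2 := by
      rw [← sq_abs]
      exact (pow_le_pow_left₀ (abs_nonneg _) h3 2).trans (le_of_eq (by ring))
    calc _ ≤ ω.1 ^ 2 * ((L * (1 + ‖ω.2.1‖ + |ω.2.2|)) ^ 2 / n) := by gcongr
      _ = (ω.1 * (L * (1 + ‖ω.2.1‖ + |ω.2.2|))) ^ 2 / n := by ring
      _ ≤ 9 * L ^ 2 * quadWeight ω ^ 3 / n := by
          gcongr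
          exact h4.trans (by gcongr)
      _ = _ := by ring
  have h5 : signMean (fun η ↦ (ω.1 * tangentVar κ σ x η ω.2) ^ 2) ≤
      81 * L ^ 8 * Q ^ 2 / n * quadWeight ω ^ 3 := by
    -- One factor of `tangentVar` is bounded deterministically, so its first moment `O(1/n)`
    -- suffices and no fourth moment of the signs is needed.
    have h6 : ∀ η, (ω.1 * tangentVar κ σ x η ω.2) ^ 2 ≤
        (ω.1 ^ 2 * (9 * L ^ 4 * Q * ‖ω.2.1‖ ^ 2)) * tangentVar κ σ x η ω.2 := fun η ↦ by
      have h7 := h.tangentVar_le h₀ hn hx η ω.2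
      have h8 := tangentVar_nonneg κ σ x η ω.2
      calc _ = ω.1 ^ 2 * tangentVar κ σ x η ω.2 * tangentVar κ σ x η ω.2 := by ring
        _ ≤ _ := by gcongr
    refine (signMean_mono h6).trans ?_
    rw [signMean_const_mul]
    calc _ ≤ (ω.1 ^ 2 * (9 * L ^ 4 * Q * ‖ω.2.1‖ ^ 2)) *
          (9 * L ^ 4 * Q * ‖ω.2.1‖ ^ 2 / n) := by
          gcongr; exact h.signMean_tangentVar_le h₀ hn hx ω.2
      _ = 81 * L ^ 8 * Q ^ 2 / n * (ω.1 * ‖ω.2.1‖ ^ 2) ^ 2 := by ring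
      _ ≤ _ := by gcongr; exact out_mul_sq_le ω
  have h9 : r ^ 2 ≤ 1 / n := by rw [le_div_iff₀ hn']; exact hrn
  unfold outEnergy energyConst
  rw [signMean_add, signMean_add, signMean_const_mul, signMean_const, signMean_const_mul]
  calc _ ≤ 2 * (9 * L ^ 2 / n * quadWeight ω ^ 3) +
        4 * c₃ ^ 2 * (1 / n) * (4 * quadWeight ω ^ 3) +
        4 * c₄ ^ 2 * (81 * L ^ 8 * Q ^ 2 / n * quadWeight ω ^ 3) := by
        gcongr; exact out_mul_one_add_sq_le ω
    _ = _ := by ring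

theorem IsActivation.integrable_outEnergy (h : IsActivation L σ)
    (h₀ : HasExpMoment (layerInit d) κ Q) (h₁ : HasExpMoment (outInit d) κ' Q')
    (hn : 0 < n) (hx : ∀ i, ‖x i‖ ≤ 1) (hr : 0 < r) (hr1 : r ≤ 1) (η : Fin n → ℤˣ) :
    Integrable (fun ω ↦ outEnergy κ c₃ c₄ r σ x η ω * expWeight κ' ω) (outInit d) := by
  refine h₁.integrable_of_le ?_ (energyConst L Q c₃ c₄) fun ω ↦ ?_
  · have hσ := h.continuous
    have hV : Measurable fun ω : OutParam d ↦ tangentVar κ σ x η ω.2 :=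
      (h.stronglyMeasurable_tangentVar κ x η).measurable.comp measurable_snd
    have hg : Continuous fun ω : OutParam d ↦
        signAvg η (fun i ↦ σ (⟪ω.2.1, x i⟫ + ω.2.2)) := by
      unfold signAvg; fun_prop
    have hg' := hg.measurable
    unfold outEnergy
    exact Measurable.aestronglyMeasurable (by fun_prop)
  · have he := (expWeight_pos κ' ω).le
    rw [abs_of_nonneg (mul_nonneg (outEnergy_nonneg _ _ _ _ _ _ _ _) he), ← mul_assoc]
    exact mul_le_mul_of_nonneg_right (h.outEnergy_le h₀ hn hx hr hr1 η ω) he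

theorem IsActivation.signMean_integral_outEnergy_le (h : IsActivation L σ)
    (h₀ : HasExpMoment (layerInit d) κ Q) (h₁ : HasExpMoment (outInit d) κ' Q')
    (hn : 0 < n) (hx : ∀ i, ‖x i‖ ≤ 1) (hr : 0 < r) (hr1 : r ≤ 1) (hrn : r ^ 2 * n ≤ 1) :
    signMean (fun η ↦ ∫ ω, outEnergy κ c₃ c₄ r σ x η ω * expWeight κ' ω ∂(outInit d)) ≤
      energyConst L Q c₃ c₄ / n * Q' := by
  rw [signMean_integral fun η ↦ h.integrable_outEnergy h₀ h₁ hn hx hr hr1 η]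
  have heq : ∀ ω : OutParam d,
      signMean (fun η ↦ outEnergy κ c₃ c₄ r σ x η ω * expWeight κ' ω) =
        expWeight κ' ω * signMean (fun η ↦ outEnergy κ c₃ c₄ r σ x η ω) := fun ω ↦ by
    rw [← signMean_const_mul]; simp only [mul_comm]
  simp only [heq]
  have hC := energyConst_nonneg L Q c₃ c₄
  refine h₁.integral_le_of_le (fun ω ↦ mul_nonneg (expWeight_pos κ' ω).le ?_) (by positivity)
    fun ω ↦ ?_
  · rw [← signMean_const (n := n) 0]
    exact signMean_mono fun η ↦ outEnergy_nonneg _ _ _ _ _ _ _ _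
  · rw [mul_comm, ← mul_assoc]
    exact mul_le_mul_of_nonneg_right (h.signMean_outEnergy_le h₀ hn hx hrn ω)
      (expWeight_pos κ' ω).le

/-- Coefficient of the second-order term in the effect of the flow on a signed average. -/
def flowConst (α κ Q L : ℝ) : ℝ :=
  α * (3 * L ^ 2 / κ) + 9 * L * (α * (1 / κ + κ * Q) * L) ^ 2 * (1 + 9 * L)

/-- For fixed signs, the signed average of the outputs is bounded uniformly over the
relative-entropy ball. -/
theorem IsActivation.integral_signAvg_le (h : IsActivation L σ) (hL1 : 1 ≤ L)
    (h₀ : HasExpMoment (layerInit d) κ Q) (h₁ : HasExpMoment (outInit d) κ' Q')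
    (hn : 0 < n) (hx : ∀ i, ‖x i‖ ≤ 1) (hα : 0 ≤ α) (hr : 0 < r) (hr1 : r ≤ 1)
    (hsmall : 3 * α * (1 / κ + κ * Q) * L * √r ≤ 1 / 4) (η : Fin n → ℤˣ) {K : ℝ} (hK0 : 0 ≤ K)
    (hK : ∀ (w : Feat d) b, |signAvg η (fun i ↦ σ (⟪w, x i⟫ + b))| ≤ K * (1 + ‖w‖ + |b|))
    {τ : Measure (OutParam d)} (hτ : OutP2 τ) (hklτ : klDiv τ (outInit d) ≤ ENNReal.ofReal r)
    {ν : Kernel ℝ (LayerParam d)} (hν : ∀ s ∈ Icc (0 : ℝ) 1, LayerP2 (ν s))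
    (hkl : ∀ s ∈ Icc (0 : ℝ) 1, klDiv (ν s) (layerInit d) ≤ ENNReal.ofReal r)
    {Z : Fin n → ℝ → Feat d} (hZ : ∀ i, IsFlow σ α ν (x i) (Z i)) :
    ∫ ω, ω.1 * signAvg η (fun i ↦ σ (⟪ω.2.1, Z i 1⟫ + ω.2.2)) ∂τ ≤
      √r / √n + r * (3 * K + (9 * α * (1 / κ + κ * Q) * L ^ 2 + 1) * √r) / κ' +
        √r * √n * ∫ ω, outEnergy κ (flowConst α κ Q L) (α * κ) r σ x η ω * expWeight κ' ω
          ∂(outInit d) := by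
  have := hτ.1
  have hn' : (0 : ℝ) < n := by exact_mod_cast hn
  have hκ := h₀.pos
  have hκ' := h₁.pos
  have hQ := h₀.nonneg
  have hL := h.nonneg
  have hσ := h.continuous
  have hs : 0 < √r := Real.sqrt_pos.2 hr
  have hsn : 0 < √(n : ℝ) := Real.sqrt_pos.2 hn'
  have hss : √r * √r = r := Real.mul_self_sqrt hr.le
  set a₁ := 9 * α * (1 / κ + κ * Q) * L ^ 2 with ha₁
  have ha₁0 : 0 ≤ a₁ := by positivity
  set c₃ := flowConst α κ Q L with hc₃
  set c₄ := α * κ with hc₄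
  -- The envelope of `H`: `3 K` from the initial points, `a₁ √r` from the flow. The extra `√r` only
  -- makes `K'` positive, since `K` and `a₁` may vanish.
  set K' := 3 * K + (a₁ + 1) * √r with hK'
  have hK'0 : 0 < K' := by positivity
  let g₀ : Feat d × ℝ → ℝ := fun p ↦ signAvg η (fun i ↦ σ (⟪p.1, x i⟫ + p.2))
  let D : Feat d × ℝ → ℝ := fun p ↦
    signAvg η (fun i ↦ σ (⟪p.1, Z i 1⟫ + p.2) - σ (⟪p.1, x i⟫ + p.2))
  let g : Feat d × ℝ → ℝ := fun p ↦ signAvg η (fun i ↦ σ (⟪p.1, Z i 1⟫ + p.2))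
  have hg : ∀ p, g p = g₀ p + D p := fun p ↦ by
    simp only [g, g₀, D, signAvg_sub]; ring
  have hcont : Continuous fun ω : OutParam d ↦ ω.1 * g ω.2 := by
    simp only [g, signAvg]; fun_prop
  have hbound : ∀ ω : OutParam d, |ω.1 * g ω.2| ≤ K' * quadWeight ω := by
    intro ω
    have h2 : |ω.1 * g₀ ω.2| ≤ 3 * K * quadWeight ω := abs_out_mul_le hK0 ω (hK _ _)
    have h3 : |ω.1 * D ω.2| ≤ a₁ * √r * quadWeight ω := by
      have h4 : |D ω.2| ≤ a₁ * √r * ‖ω.2.1‖ :=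
        h.abs_signAvg_flow_sub_le_sqrt h₀ hn hx hα hr hr1 hsmall hν hkl hZ η ω.2
      obtain ⟨h5, h6, -⟩ := outParam_norm_le ω
      rw [abs_mul]
      calc |ω.1| * |D ω.2| ≤ ‖ω‖ * (a₁ * √r * ‖ω‖) := by
            gcongr; exact h4.trans (by gcongr)
        _ = a₁ * √r * (‖ω‖ ^ 2) := by ring
        _ ≤ _ := by gcongr; unfold quadWeight; linarith
    have hq := quadWeight_pos ω
    rw [hg, mul_add]
    refine (abs_add_le _ _).trans ((add_le_add h2 h3).trans ?_)
    rw [hK']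
    nlinarith [mul_pos hs hq]
  have hG2 : ∫ ω, (ω.1 * g ω.2) ^ 2 * expWeight κ' ω ∂(outInit d) ≤
      ∫ ω, outEnergy κ c₃ c₄ r σ x η ω * expWeight κ' ω ∂(outInit d) := by
    refine integral_mono_of_nonneg
      (ae_of_all _ fun ω ↦ mul_nonneg (sq_nonneg _) (expWeight_pos κ' ω).le)
      (h.integrable_outEnergy h₀ h₁ hn hx hr hr1 η) (ae_of_all _ fun ω ↦ ?_)
    refine mul_le_mul_of_nonneg_right ?_ (expWeight_pos κ' ω).le
    have h2 : |D ω.2| ≤ c₃ * (1 + ‖ω.2.1‖) ^ 2 * r + c₄ * tangentVar κ σ x η ω.2 :=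
      h.abs_signAvg_flow_sub_le hL1 h₀ hn hx hα hr hr1 hsmall hν hkl hZ η ω.2
    have h3 : D ω.2 ^ 2 ≤ 2 * (c₃ * (1 + ‖ω.2.1‖) ^ 2 * r) ^ 2 +
        2 * (c₄ * tangentVar κ σ x η ω.2) ^ 2 := by
      have h4 : D ω.2 ^ 2 ≤ (c₃ * (1 + ‖ω.2.1‖) ^ 2 * r + c₄ * tangentVar κ σ x η ω.2) ^ 2 := by
        rw [← sq_abs (D ω.2)]; exact pow_le_pow_left₀ (abs_nonneg _) h2 2
      exact h4.trans (add_sq_le.trans (le_of_eq (by ring)))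
    calc (ω.1 * g ω.2) ^ 2 = ω.1 ^ 2 * (g₀ ω.2 + D ω.2) ^ 2 := by rw [hg]; ring
      _ ≤ ω.1 ^ 2 * (2 * (g₀ ω.2 ^ 2 + D ω.2 ^ 2)) := by gcongr; exact add_sq_le
      _ ≤ ω.1 ^ 2 * (2 * (g₀ ω.2 ^ 2 + (2 * (c₃ * (1 + ‖ω.2.1‖) ^ 2 * r) ^ 2 +
          2 * (c₄ * tangentVar κ σ x η ω.2) ^ 2))) := by gcongr
      _ = outEnergy κ c₃ c₄ r σ x η ω := by simp only [outEnergy, g₀]; ring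
  set T := ∫ ω, outEnergy κ c₃ c₄ r σ x η ω * expWeight κ' ω ∂(outInit d) with hT
  have hT0 : 0 ≤ T := integral_nonneg fun ω ↦
    mul_nonneg (outEnergy_nonneg _ _ _ _ _ _ _ _) (expWeight_pos κ' ω).le
  -- The first entry is the target `√(rn)`, the second the admissibility cap `λ K' ≤ κ'`. Since `r /
  -- λ` is then the larger of two terms, it is at most their sum.
  set lam := min (√r * √n) (κ' / K') with hlam
  have hlam0 : 0 < lam := lt_min (by positivity) (by positivity)
  have hmain := integral_le_of_klDiv_le h₁ hr.le hklτ hcont.aestronglyMeasurable hbound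
    (integral_fst_mul_outInit g)
    (integrable_of_abs_le_quadWeight hτ.integrable_quadWeight hcont.aestronglyMeasurable hbound)
    hlam0 ((mul_le_mul_of_nonneg_right (min_le_right _ _) hK'0.le).trans
      (le_of_eq (div_mul_cancel₀ _ hK'0.ne')))
  have h5 : r / lam ≤ √r / √n + r * K' / κ' := by
    rcases min_choice (√r * √n) (κ' / K') with h6 | h6 <;> rw [hlam, h6]
    · have h7 : r / (√r * √n) = √r / √n := by
        nth_rewrite 1 [← hss]; field_simp
      rw [h7]
      have : 0 ≤ r * K' / κ' := by positivity
      linarith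
    · have h7 : r / (κ' / K') = r * K' / κ' := by field_simp
      rw [h7]
      have : 0 ≤ √r / √n := by positivity
      linarith
  refine hmain.trans (add_le_add h5 ?_)
  calc _ ≤ lam * T := by gcongr
    _ ≤ _ := by gcongr; exact min_le_left _ _

theorem signedMean_resNet {β : ℝ} {τ : Measure (OutParam d)}
    (h : IsActivation L σ) (hτ : OutP2 τ) {Z : Feat d → ℝ → Feat d} {f : Feat d → ℝ}
    (hf : ∀ x, f x = β * ∫ ω, outMap σ (Z x 1) ω ∂τ) (η : Fin n → ℤˣ) :
    signedMean x η f =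
      β * ∫ ω, ω.1 * signAvg η (fun i ↦ σ (⟪ω.2.1, Z (x i) 1⟫ + ω.2.2)) ∂τ := by
  have hσ := h.continuous
  have hL := h.nonneg
  have hint : ∀ i, Integrable (outMap σ (Z (x i) 1)) τ := fun i ↦ by
    refine integrable_of_abs_le_quadWeight hτ.integrable_quadWeight
      (K := 3 * (L * (1 + ‖Z (x i) 1‖))) (Continuous.aestronglyMeasurable ?_) fun ω ↦ ?_
    · unfold outMap; fun_prop
    · exact abs_out_mul_le (by positivity) ω
        ((h.abs_neuron_le _ _ _).trans (le_of_eq (by ring)))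
  have h1 : signedMean x η f = signAvg η (fun i ↦ β * ∫ ω, outMap σ (Z (x i) 1) ω ∂τ) := by
    simp only [signedMean, signAvg, hf]
  rw [h1, signAvg_const_mul, signAvg_integral η hint]
  simp only [outMap, signAvg_const_mul]

end Output

end

/-! ### Choice of constants and average over the signs. -/

theorem mainTheorem3 (d : ℕ) (α : ℝ) (hα : 0 ≤ α) (C₁ : ℝ) :
    ∃ c C : ℝ, 0 < c ∧ 0 < C ∧
      ∀ (σ₀ : ℝ → ℝ), IsActivation C₁ σ₀ →
      ∀ (β : ℝ), 0 ≤ β →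
      ∀ (n : ℕ), 0 < n →
      ∀ (x : Fin n → Feat d), (∀ i, ‖x i‖ ≤ 1) →
      ∀ (r : ℝ), 0 < r → r ≤ c / √(n : ℝ) →
        (∀ η : Fin n → ℤˣ, BddAbove (signedMean x η '' klClass d σ₀ α β r)) ∧
        rademacher x (klClass d σ₀ α β r) ≤ C * β * √(r / n) := by
  obtain ⟨κ, Q, h₀⟩ := exists_hasExpMoment (layerInit d)
  obtain ⟨κ', Q', h₁⟩ := exists_hasExpMoment (outInit d)
  have hκ := h₀.pos
  have hκ' := h₁.pos
  have hQ := h₀.nonneg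
  have hQ' := h₁.nonneg
  -- Enlarging the constant to at least `1` allows `L ≤ L²` and keeps denominators in `L` positive.
  set L : ℝ := max C₁ 1 with hLdef
  have hL1 : 1 ≤ L := le_max_right _ _
  have hL0 : 0 ≤ L := by linarith
  set S : ℝ := α * (1 / κ + κ * Q) * L with hS
  have hS0 : 0 ≤ S := by positivity
  set a₁ : ℝ := 9 * α * (1 / κ + κ * Q) * L ^ 2 with ha₁
  have ha₁0 : 0 ≤ a₁ := by positivity
  set c₃ : ℝ := flowConst α κ Q L with hc₃
  set c₄ : ℝ := α * κ with hc₄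
  set c₅ : ℝ := energyConst L Q c₃ c₄ with hc₅
  have hc₅0 : 0 ≤ c₅ := energyConst_nonneg _ _ _ _
  set cK : ℝ := L * (d + 2) * (8 * d + 12) with hcK
  have hcK0 : 0 ≤ cK := by positivity
  -- This `c` forces `3 S √r ≤ 1/4`, the smallness needed for the trajectories. Being at most `1`,
  -- it also gives `r ≤ 1/√n`.
  refine ⟨(1 / (12 * S + 1)) ^ 2, 1 + (3 * cK + (a₁ + 1)) / κ' + c₅ * Q', by positivity,
    by positivity, ?_⟩
  intro σ hσ β hβ n hn x hx r hr hrc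
  have h := hσ.mono (le_max_left C₁ 1)
  rw [← hLdef] at h
  have hn1 : (1 : ℝ) ≤ n := by exact_mod_cast hn
  have hn' : (0 : ℝ) < n := by linarith
  have hsn1 : 1 ≤ √(n : ℝ) := Real.one_le_sqrt.2 hn1
  have hsn : 0 < √(n : ℝ) := by linarith
  have hsnn : √(n : ℝ) * √n = n := Real.mul_self_sqrt hn'.le
  have hs : 0 < √r := Real.sqrt_pos.2 hr
  have hss : √r * √r = r := Real.mul_self_sqrt hr.le
  have hinv : 1 / (12 * S + 1) ≤ 1 := by
    rw [div_le_one (by positivity)]; linarith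
  have hc1 : (1 / (12 * S + 1)) ^ 2 ≤ 1 := pow_le_one₀ (by positivity) hinv
  have hrn1 : r ≤ 1 / √n := hrc.trans (by gcongr)
  have hrc' : r ≤ (1 / (12 * S + 1)) ^ 2 := hrc.trans (div_le_self (by positivity) hsn1)
  have hr1 : r ≤ 1 := hrc'.trans hc1
  have hsmall : 3 * α * (1 / κ + κ * Q) * L * √r ≤ 1 / 4 := by
    have h2 : √r ≤ 1 / (12 * S + 1) := (Real.sqrt_le_left (by positivity)).2 hrc'
    have h3 : 3 * α * (1 / κ + κ * Q) * L * √r = 3 * S * √r := by rw [hS]; ring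
    rw [h3]
    calc 3 * S * √r ≤ 3 * S * (1 / (12 * S + 1)) := by gcongr
      _ ≤ 1 / 4 := by
        rw [mul_one_div, div_le_div_iff₀ (by positivity) (by norm_num)]
        linarith
  have hrn : r ^ 2 * n ≤ 1 := by
    have h2 : r * √n ≤ 1 := by rwa [le_div_iff₀ hsn] at hrn1
    calc r ^ 2 * n = (r * √n) ^ 2 := by rw [mul_pow, sq (√(n : ℝ)), hsnn]
      _ ≤ 1 := pow_le_one₀ (by positivity) h2
  obtain ⟨K, hK0, hK, hKmean⟩ :=
    exists_ridge_envelope hL0 h.abs_sub_le h.abs_le hn hx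
  let T : (Fin n → ℤˣ) → ℝ := fun η ↦
    ∫ ω, outEnergy κ c₃ c₄ r σ x η ω * expWeight κ' ω ∂(outInit d)
  let B : (Fin n → ℤˣ) → ℝ := fun η ↦
    √r / √n + r * (3 * K η + (a₁ + 1) * √r) / κ' + √r * √n * T η
  have hT0 : ∀ η, 0 ≤ T η := fun η ↦ integral_nonneg fun ω ↦
    mul_nonneg (outEnergy_nonneg _ _ _ _ _ _ _ _) (expWeight_pos κ' ω).le
  have hB0 : ∀ η, 0 ≤ B η := fun η ↦ by
    have := hT0 η
    have := hK0 η
    positivity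
  have hle : ∀ η, ∀ f ∈ klClass d σ α β r, signedMean x η f ≤ β * B η := by
    rintro η f ⟨τ, ν, ⟨hτ, hν, Z, hZ, hf⟩, hklτ, hkl⟩
    rw [signedMean_resNet h hτ hf η]
    exact mul_le_mul_of_nonneg_left (h.integral_signAvg_le hL1 h₀ h₁ hn hx hα hr hr1 hsmall η
      (hK0 η) (hK η) hτ hklτ hν hkl fun i ↦ hZ (x i)) hβ
  refine ⟨fun η ↦ ⟨β * B η, ?_⟩, ?_⟩
  · rintro _ ⟨f, hf, rfl⟩
    exact hle η f hf
  have h1 : rademacher x (klClass d σ α β r) ≤ signMean fun η ↦ β * B η :=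
    -- A real supremum over an empty family is `0`, so nonnegativity of the bound replaces
    -- nonemptiness of the class.
    signMean_mono (X := fun η ↦ ⨆ f : klClass d σ α β r, signedMean x η f.1) fun η ↦
      Real.iSup_le (fun f ↦ hle η f.1 f.2) (mul_nonneg hβ (hB0 η))
  refine h1.trans ?_
  have hBmean : signMean B ≤ (1 + (3 * cK + (a₁ + 1)) / κ' + c₅ * Q') * (√r / √n) := by
    have hB : B = fun η ↦ (√r / √n + r * ((a₁ + 1) * √r) / κ') + (3 * r / κ' * K η +
        √r * √n * T η) := by
      funext η; simp only [B]; ring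
    have hTmean : signMean T ≤ c₅ / n * Q' :=
      h.signMean_integral_outEnergy_le h₀ h₁ hn hx hr hr1 hrn
    rw [hB, signMean_add, signMean_const, signMean_add, signMean_const_mul, signMean_const_mul]
    set ρ := √(√(n : ℝ)) with hρ
    have hρ0 : 0 < ρ := Real.sqrt_pos.2 hsn
    have hρρ : ρ * ρ = √n := Real.mul_self_sqrt hsn.le
    -- This is `r ≤ 1/√n` in the form `√r ≤ n^(-1/4)`; it turns the ridge-envelope term `r n^(-1/4)`
    -- into `√r / √n`.
    have h2 : √r ≤ 1 / ρ := by
      rw [le_div_iff₀ hρ0, hρ, ← Real.sqrt_mul hr.le]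
      exact Real.sqrt_le_one.2 ((le_div_iff₀ hsn).1 hrn1)
    have h3 : r * (1 / ρ) ≤ √r / √n := by
      calc r * (1 / ρ) = √r * √r * (1 / ρ) := by rw [hss]
        _ ≤ √r * (1 / ρ) * (1 / ρ) := by gcongr
        _ = √r / (ρ * ρ) := by field_simp
        _ = _ := by rw [hρρ]
    have h4 : r * √r ≤ √r / √n := by
      calc r * √r ≤ 1 / √n * √r := by gcongr
        _ = _ := by ring
    have h5 : √n / (n : ℝ) = 1 / √n := by
      nth_rewrite 2 [← hsnn]; field_simp
    calc √r / √n + r * ((a₁ + 1) * √r) / κ' + (3 * r / κ' * signMean K + √r * √n * signMean T)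
        ≤ √r / √n + r * ((a₁ + 1) * √r) / κ' +
            (3 * r / κ' * (cK / ρ) + √r * √n * (c₅ / n * Q')) := by gcongr
      _ = √r / √n + (a₁ + 1) / κ' * (r * √r) + 3 * cK / κ' * (r * (1 / ρ)) +
            c₅ * Q' * (√r * (√n / n)) := by ring
      _ ≤ √r / √n + (a₁ + 1) / κ' * (√r / √n) + 3 * cK / κ' * (√r / √n) +
            c₅ * Q' * (√r * (1 / √n)) := by rw [h5]; gcongr
      _ = _ := by ring
  rw [signMean_const_mul, Real.sqrt_div hr.le]
  calc β * signMean B ≤ β * ((1 + (3 * cK + (a₁ + 1)) / κ' + c₅ * Q') * (√r / √n)) := by gcongr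
    _ = _ := by ring
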